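/- Let $\nu\ge 0$, $\lambda>0$, and let $F:\mathbb R\to\mathbb R$ be Lipschitz continuous on bounded sets with $F(0)=0$ and $F(s)s\le 0$ for all $s\in\mathbb R$. Let $\ell_2$ be the Hilbert space of square-summable real sequences indexed by $\mathbb Z$, and let $\mathfrak f=(f_i)_{i\in\mathbb Z}\in C_b(\mathbb R,\ell_2)$ be a bounded continuous function. Consider in $\ell_2$ the lattice system $$u_i'=\nu(u_{i-1}-2u_i+u_{i+1})-\lambda u_i+F(u_i)+f_i(t),\qquad i\in\mathbb Z, \tag{1}$$ and, for $n\ge 1$, its approximation in $\mathbb R^{2n+1}$ with periodic boundary conditions $$v_i'=\nu(v_{i-1}-2v_i+v_{i+1})-\lambda v_i+F(v_i)+f_i(t),\qquad |i|\le n,\quad v_{n+1}:=v_{-n},\ v_{-n-1}:=v_n, \tag{2}$$ whose forcing is $\mathfrak f^n:=(f_i)_{|i|\le n}$. For a continuous function $g$ on $\mathbb R$ write $\sigma(h,g):=g(\cdot+h)$, and let $H(g)$ be the closure of $\{\sigma(h,g): h\in\mathbb R\}$ in the compact-open topology. For $t\ge 0$ let $\varphi(t,x,g)$, $g\in H(\mathfrak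 f)$, be the value at time $t$ of the solution of (1) with forcing $g$ in place of $\mathfrak f$ that starts at $x\in\ell_2$ at time $0$, and define $\varphi_n(t,x,g)$, $x\in\mathbb R^{2n+1}$, $g\in H(\mathfrak f^n)$, in the same way from (2). A cocycle $\psi$ over $Y$ with fibre $W$ is uniformly compactly dissipative if there is a nonempty compact $K\subseteq W$ such that $\sup_{y\in Y}\sup_{x\in M}\operatorname{dist}(\psi(t,x,y),K)\to 0$ as $t\to+\infty$ for every compact $M\subseteq W$. Its compact global attractor (Levinson center) is then the family $$I_y=\bigcap_{t\ge 0}\overline{\bigcup_{\tau\ge t}\psi(\tau,K,\sigma(-\tau,y))},\qquad y\in Y,$$ which does not depend on the choice of $K$. Let $\{I^n_g: g\in H(\mathfrak f^n)\}$ and $\{I_g: g\in H(\mathfrak f)\}$ be the compact global attractors of $\varphi_n$ and $\varphi$. Assume that $\mathfrak f$ is Lagrange stable, i.e. $H(\mathfrak f)$ is compact, or, more generally, only that $\varphi$ is uniformly compactly dissipative over $H(\mathfrak f)$, so that $I_{\mathfrak f}$ is defined. Let $v_{0,n}\in I^n_{\mathfrak f^n}$ for every $n\ge 1$, and regard $\mathbb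 R^{2n+1}$ as a subspace of $\ell_2$ (extension by zero outside $\{-n,\dots,n\}$). Then there exist a subsequence $\{v_{0,n_k}\}$ of $\{v_{0,n}\}$ and a point $u\in I_{\mathfrak f}$ such that $v_{0,n_k}\to u$ in $\ell_2$ as $k\to\infty$. -/

import Mathlib

open Filter Topology

noncomputable section

namespace LatticeSystem

/-! ### Shifts, hulls, cocycles and their Levinson centers -/

section General

/-- The translate `f^h`, `f^h (t) = f (t + h)`, of a continuous function on the line. -/
def shift {E : Type*} [TopologicalSpace E] (h : ℝ) (f : C(ℝ, E)) : C(ℝ, E) :=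
  f.comp ⟨fun t => t + h, by fun_prop⟩

/-- The hull `H(f)`: the closure of the set of all translates of `f` in `C(ℝ, E)` with the
compact-open topology. -/
def hull {E : Type*} [TopologicalSpace E] (f : C(ℝ, E)) : Set C(ℝ, E) :=
  closure (Set.range fun h : ℝ => shift h f)

/-- `f` is Lagrange stable (translation-compact): its hull is compact. -/
def IsLagrangeStable {E : Type*} [TopologicalSpace E] (f : C(ℝ, E)) : Prop :=
  IsCompact (hull f)

variable {W Y : Type*} [MetricSpace W]

/-- `K` is a nonempty compact set with `sup_{y ∈ Y₀} β (φ(t, M, y), K) → 0` as `t → ∞` for every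
compact `M`, where `β (A, B) = sup_{a ∈ A} dist (a, B)`. -/
def IsUniformlyAttracting (φ : ℝ → W → Y → W) (Y₀ : Set Y) (K : Set W) : Prop :=
  K.Nonempty ∧ IsCompact K ∧
    ∀ M : Set W, IsCompact M → ∀ ε > 0, ∃ T ≥ (0 : ℝ), ∀ t ≥ T, ∀ y ∈ Y₀, ∀ x ∈ M,
      Metric.infDist (φ t x y) K < ε

/-- The cocycle `φ` over `Y₀` is uniformly compactly dissipative. -/
def IsUniformlyCompactlyDissipative (φ : ℝ → W → Y → W) (Y₀ : Set Y) : Prop :=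
  ∃ K : Set W, IsUniformlyAttracting φ Y₀ K

/-- `ω_y(K) = ⋂_{t ≥ 0} closure (⋃_{τ ≥ t} φ (τ, K, σ (-τ, y)))`. -/
def omegaFiber (φ : ℝ → W → Y → W) (σ : ℝ → Y → Y) (K : Set W) (y : Y) : Set W :=
  ⋂ t ∈ Set.Ici (0 : ℝ), closure (⋃ τ ∈ Set.Ici t, (fun x => φ τ x (σ (-τ) y)) '' K)

/-- The fibre `I_y` over `y ∈ Y₀` of the Levinson center (compact global attractor) of a uniformly
compactly dissipative cocycle: `I_y = ω_y(K)` with `K` a nonempty compact set that attracts all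
compact sets uniformly. The set `ω_y(K)` is the same for all such `K`, and the union over `K` is
taken only to avoid a choice of `K`. -/
def levinsonCenter (φ : ℝ → W → Y → W) (σ : ℝ → Y → Y) (Y₀ : Set Y) (y : Y) : Set W :=
  {x | ∃ K : Set W, IsUniformlyAttracting φ Y₀ K ∧ x ∈ omegaFiber φ σ K y}

end General

/-! ### The lattice system -/

/-- The Hilbert space of square-summable two-sided real sequences. -/
abbrev Ell2 : Type := lp (fun _ : ℤ => ℝ) 2

/-- `u` solves, on `[0, ∞)` and in the Banach space `ℓ₂`, the equation
`u' = ν A u - lam u + F(u) + g(t)`, where `(A u)_i = u_{i-1} - 2 u_i + u_{i+1}` and `F` acts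
coordinatewise: at every `t ≥ 0` the derivative exists in the norm of `ℓ₂`, and its coordinates
are those of the right-hand side. -/
def IsLatticeSolution (ν lam : ℝ) (F : ℝ → ℝ) (g : C(ℝ, Ell2)) (u : ℝ → Ell2) : Prop :=
  ∀ t ≥ (0 : ℝ), ∃ w : Ell2,
    (∀ i : ℤ, w i = ν * (u t (i - 1) - 2 * u t i + u t (i + 1)) - lam * u t i + F (u t i) + g t i) ∧
    HasDerivWithinAt u w (Set.Ici 0) t

open Classical in
/-- The cocycle of the lattice system: for `t ≥ 0`, `latticeCocycle ν lam F t x g` is the value at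
`t` of the solution with forcing `g` that starts at `x` at time `0`. -/
def latticeCocycle (ν lam : ℝ) (F : ℝ → ℝ) (t : ℝ) (x : Ell2) (g : C(ℝ, Ell2)) : Ell2 :=
  if h : ∃ u : ℝ → Ell2, IsLatticeSolution ν lam F g u ∧ u 0 = x then h.choose t else 0

/-! ### The finite-dimensional approximations -/

/-- The index set `{-n, …, n}`. -/
abbrev Idx (n : ℕ) : Type := ↥(Finset.Icc (-(n : ℤ)) (n : ℤ))

/-- The space `ℝ^{2n+1}` with the Euclidean norm and coordinates indexed by `{-n, …, n}`. -/
abbrev FinSpace (n : ℕ) : Type := EuclideanSpace ℝ (Idx n)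

/-- The cyclic successor on `{-n, …, n}`. -/
def cyclicSucc {n : ℕ} (i : Idx n) : Idx n :=
  if h : (i : ℤ) = n then ⟨-(n : ℤ), by simp⟩
  else ⟨(i : ℤ) + 1, by
    have := Finset.mem_Icc.mp i.2
    exact Finset.mem_Icc.mpr ⟨by omega, by omega⟩⟩

/-- The cyclic predecessor on `{-n, …, n}`. -/
def cyclicPred {n : ℕ} (i : Idx n) : Idx n :=
  if h : (i : ℤ) = -(n : ℤ) then ⟨(n : ℤ), by simp⟩
  else ⟨(i : ℤ) - 1, by
    have := Finset.mem_Icc.mp i.2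
    exact Finset.mem_Icc.mpr ⟨by omega, by omega⟩⟩

/-- The right-hand side `-ν A_n v - lam v + F(v) + b` of the approximating system, where `A_n` is
the `(2n+1) × (2n+1)` discrete Laplacian `(A_n v)_i = -v_{i-1} + 2 v_i - v_{i+1}` with periodic
boundary conditions. -/
def finField (ν lam : ℝ) (F : ℝ → ℝ) {n : ℕ} (b v : FinSpace n) : FinSpace n :=
  WithLp.toLp 2 fun i =>
    ν * (v (cyclicPred i) - 2 * v i + v (cyclicSucc i)) - lam * v i + F (v i) + b i

/-- `v` solves the approximating system with forcing `g` on `[0, ∞)`. -/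
def IsFinSolution (ν lam : ℝ) (F : ℝ → ℝ) {n : ℕ} (g : C(ℝ, FinSpace n)) (v : ℝ → FinSpace n) :
    Prop :=
  ∀ t ≥ (0 : ℝ), HasDerivWithinAt v (finField ν lam F (g t) (v t)) (Set.Ici 0) t

open Classical in
/-- The cocycle of the approximating system: for `t ≥ 0`, `finCocycle ν lam F n t x g` is the value
at `t` of the solution with forcing `g` that starts at `x` at time `0`. -/
def finCocycle (ν lam : ℝ) (F : ℝ → ℝ) (n : ℕ) (t : ℝ) (x : FinSpace n) (g : C(ℝ, FinSpace n)) :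
    FinSpace n :=
  if h : ∃ v : ℝ → FinSpace n, IsFinSolution ν lam F g v ∧ v 0 = x then h.choose t else 0

/-- The truncated forcing `𝔣^n (t) = (𝔣_i (t))_{|i| ≤ n}`. -/
def truncate (n : ℕ) (f : C(ℝ, Ell2)) : C(ℝ, FinSpace n) where
  toFun t := WithLp.toLp 2 fun i => f t (i : ℤ)
  continuous_toFun := by
    refine (PiLp.continuous_toLp 2 _).comp (continuous_pi fun i => ?_)
    exact ((lp.evalCLM ℝ (fun _ : ℤ => ℝ) 2 (i : ℤ)).continuous.comp f.continuous)

/-- The isometric embedding of `ℝ^{2n+1}` into `ℓ₂` by zeros outside `{-n, …, n}`. -/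
def embed (n : ℕ) (v : FinSpace n) : Ell2 :=
  ∑ i : Idx n, lp.single 2 (i : ℤ) (v i)

end LatticeSystem

end

open LatticeSystem

noncomputable section

namespace LatticeSystem

/-! ### Coordinates, norms and diagonal operators in `ℓ₂` -/

section Ell2

/-! A point of the attractor of a finite system is nearly the endpoint of a long trajectory. With
`K` bounded and the linear part dissipative, this trajectory can be cut so that it has length `n`,
ends within `1 / (n + 1)` of `v n`, stays in the ball of radius `C / lam + 1`, and solves the finite
system with forcing `f` shifted by `-n` (`exists_fin_solution_near`). Call it `p n`. If the points
`p n (n - m)` converge along a common subsequence to `U m` for every `m`, and the range of `U` is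
relatively compact, then `U 0` is reached from `U m` in time `m` by the lattice cocycle, hence lies
in the omega-fibre of a compact attracting set containing every `U m`, that is, in the Levinson
center.

The crux is compactness in `ℓ₂`: the tails of `p n t` must be small uniformly in large `n` and `t`.
Smallness of the tails of `f` is not available under mere dissipativity. Instead `p n` is compared
with the lattice solution `w n` that starts at zero and has the same forcing. Its tails are
eventually small because `K` attracts `{0}` uniformly over the hull. In the weighted energy of `p n
- w n` the forcing cancels, the periodic boundary defect involves only far coordinates of `w n`, and
the nonlinear term is, up to the nonpositive `F(p) p`, a sum of terms each carrying a factor `w n`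
(`exists_deriv_energy_le`, `fin_tail_le`).

The limits are identified by a Gronwall estimate on bounded time intervals
(`fin_approximates_lattice`). Lagrange stability reduces to dissipativity, since the values of all
functions in a compact hull form a compact set and so have uniformly small tails. -/

theorem summable_sq (x : Ell2) : Summable fun i => x i ^ 2 := by
  have h := (lp.memℓp x).summable (by norm_num : 0 < (2 : ENNReal).toReal)
  simpa using h

theorem norm_sq_eq (x : Ell2) : ‖x‖ ^ 2 = ∑' i, x i ^ 2 := by
  have h := lp.norm_rpow_eq_tsum (by norm_num : 0 < (2 : ENNReal).toReal) x
  simpa using h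

theorem inner_eq (x y : Ell2) : inner ℝ x y = ∑' i, x i * y i := by
  rw [lp.inner_eq_tsum]
  exact tsum_congr fun i => by simp [mul_comm]

theorem summable_mul (x y : Ell2) : Summable fun i => x i * y i := by
  refine (lp.summable_inner (𝕜 := ℝ) x y).congr fun i => by simp [mul_comm]

theorem abs_apply_le (x : Ell2) (i : ℤ) : |x i| ≤ ‖x‖ := by
  simpa using lp.norm_apply_le_norm (by norm_num) x i

/-- A square-summable sequence as an element of `ℓ₂`. -/
def ofSummable (x : ℤ → ℝ) (h : Summable fun i => x i ^ 2) : Ell2 :=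
  ⟨x, memℓp_gen (by simpa using h)⟩

@[simp] theorem ofSummable_apply (x : ℤ → ℝ) (h : Summable fun i => x i ^ 2) (i : ℤ) :
    ofSummable x h i = x i := rfl

theorem norm_le_of_abs_le {x y : Ell2} (h : ∀ i, |x i| ≤ |y i|) : ‖x‖ ≤ ‖y‖ := by
  refine le_of_sq_le_sq ?_ (norm_nonneg _)
  rw [norm_sq_eq, norm_sq_eq]
  exact (summable_sq x).tsum_le_tsum (fun i => sq_le_sq.mpr (h i)) (summable_sq y)

/-- Multiplication by a sequence bounded by `1`. -/
def mulOp (θ : ℤ → ℝ) (hθ : ∀ i, |θ i| ≤ 1) : Ell2 →L[ℝ] Ell2 :=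
  have key (x : Ell2) (i : ℤ) : |θ i * x i| ≤ |x i| := by
    rw [abs_mul]
    exact mul_le_of_le_one_left (abs_nonneg _) (hθ i)
  LinearMap.mkContinuous
    { toFun := fun x => ofSummable (fun i => θ i * x i)
        ((summable_sq x).of_nonneg_of_le (fun _ => sq_nonneg _) fun i => sq_le_sq.mpr (key x i))
      map_add' := fun x y => by ext i; simp [mul_add]
      map_smul' := fun c x => by ext i; simp; ring }
    1 fun x => by
      rw [one_mul]
      exact norm_le_of_abs_le fun i => key x i

@[simp] theorem mulOp_apply (θ : ℤ → ℝ) (hθ : ∀ i, |θ i| ≤ 1) (x : Ell2) (i : ℤ) :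
    mulOp θ hθ x i = θ i * x i := rfl

theorem norm_mulOp_le (θ : ℤ → ℝ) (hθ : ∀ i, |θ i| ≤ 1) (x : Ell2) : ‖mulOp θ hθ x‖ ≤ ‖x‖ := by
  refine norm_le_of_abs_le fun i => ?_
  rw [mulOp_apply, abs_mul]
  exact mul_le_of_le_one_left (abs_nonneg _) (hθ i)

/-- The projection onto the coordinates of index larger than `k` in absolute value. -/
def tail (k : ℕ) : Ell2 →L[ℝ] Ell2 :=
  mulOp (fun i => if (k : ℤ) < |i| then 1 else 0) fun i => by split_ifs <;> simp

theorem tail_apply (k : ℕ) (x : Ell2) (i : ℤ) :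
    tail k x i = if (k : ℤ) < |i| then x i else 0 := by
  simp [tail]

theorem norm_tail_le (k : ℕ) (x : Ell2) : ‖tail k x‖ ≤ ‖x‖ := norm_mulOp_le _ _ _

theorem norm_tail_le_of_abs_le {k : ℕ} {x y : Ell2} (h : ∀ i, |x i| ≤ |y i|) :
    ‖tail k x‖ ≤ ‖tail k y‖ :=
  norm_le_of_abs_le fun i => by
    rw [tail_apply, tail_apply]
    split_ifs
    exacts [h i, le_rfl]

theorem norm_tail_anti {k l : ℕ} (h : k ≤ l) (x : Ell2) : ‖tail l x‖ ≤ ‖tail k x‖ :=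
  norm_le_of_abs_le fun i => by
    rw [tail_apply, tail_apply]
    split_ifs
    · exact le_rfl
    · omega
    · simp
    · simp

theorem abs_apply_le_norm_tail {k : ℕ} {i : ℤ} (h : (k : ℤ) < |i|) (x : Ell2) :
    |x i| ≤ ‖tail k x‖ := by
  have := abs_apply_le (tail k x) i
  rwa [tail_apply, if_pos h] at this

/-! ### Restriction to and extension from `{-n, …, n}` -/

theorem mem_Icc_iff_abs {n : ℕ} {i : ℤ} : i ∈ Finset.Icc (-(n : ℤ)) (n : ℤ) ↔ |i| ≤ n := by
  rw [Finset.mem_Icc, abs_le]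

theorem embed_apply (n : ℕ) (v : FinSpace n) (i : ℤ) :
    embed n v i = if h : i ∈ Finset.Icc (-(n : ℤ)) (n : ℤ) then v ⟨i, h⟩ else 0 := by
  unfold embed
  rw [lp.coeFn_sum, Finset.sum_apply]
  split_ifs with h
  · rw [Finset.sum_eq_single (⟨i, h⟩ : Idx n)]
    · simp
    · intro j _ hj
      rw [lp.single_apply_ne]
      rintro rfl
      exact hj rfl
    · simp
  · refine Finset.sum_eq_zero fun j _ => ?_
    rw [lp.single_apply_ne]
    rintro rfl
    exact h j.2

@[simp] theorem embed_apply_coe (n : ℕ) (v : FinSpace n) (i : Idx n) : embed n v i = v i := by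
  rw [embed_apply, dif_pos i.2]

/-- The coordinates of index in `{-n, …, n}`. -/
def restrict (n : ℕ) (x : Ell2) : FinSpace n := WithLp.toLp 2 fun i => x (i : ℤ)

@[simp] theorem restrict_apply (n : ℕ) (x : Ell2) (i : Idx n) : restrict n x i = x (i : ℤ) := rfl

theorem embed_sub (n : ℕ) (v w : FinSpace n) : embed n (v - w) = embed n v - embed n w := by
  ext i
  rw [lp.coeFn_sub, Pi.sub_apply, embed_apply, embed_apply, embed_apply]
  split_ifs <;> simp

theorem norm_sq_finSpace {n : ℕ} (v : FinSpace n) : ‖v‖ ^ 2 = ∑ i, v i ^ 2 := by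
  simp [EuclideanSpace.norm_sq_eq]

theorem tsum_embed {n : ℕ} (v : FinSpace n) (G : ℤ → ℝ → ℝ) (hG : ∀ i, G i 0 = 0) :
    ∑' i, G i (embed n v i) = ∑ i : Idx n, G i (v i) := by
  rw [tsum_eq_sum (s := Finset.Icc (-(n : ℤ)) (n : ℤ))
    (fun i hi => by rw [embed_apply, dif_neg hi, hG]), ← Finset.sum_coe_sort]
  exact Finset.sum_congr rfl fun i _ => by rw [embed_apply_coe]

@[simp] theorem norm_embed (n : ℕ) (v : FinSpace n) : ‖embed n v‖ = ‖v‖ := by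
  rw [← sq_eq_sq₀ (norm_nonneg _) (norm_nonneg _), norm_sq_eq, norm_sq_finSpace]
  exact tsum_embed v (fun _ s => s ^ 2) (by simp)

theorem isometry_embed (n : ℕ) : Isometry (embed n) :=
  Isometry.of_dist_eq fun v w => by rw [dist_eq_norm, dist_eq_norm, ← embed_sub, norm_embed]

theorem embed_restrict_apply (n : ℕ) (x : Ell2) (i : ℤ) :
    embed n (restrict n x) i = if |i| ≤ n then x i else 0 := by
  rw [embed_apply]
  simp only [mem_Icc_iff_abs, restrict_apply, dite_eq_ite]

theorem embed_restrict (n : ℕ) (x : Ell2) : embed n (restrict n x) = x - tail n x := by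
  ext i
  rw [embed_restrict_apply, lp.coeFn_sub, Pi.sub_apply, tail_apply]
  split_ifs <;> first | omega | simp

theorem norm_restrict_le (n : ℕ) (x : Ell2) : ‖restrict n x‖ ≤ ‖x‖ := by
  rw [← norm_embed]
  refine norm_le_of_abs_le fun i => ?_
  rw [embed_restrict_apply]
  split_ifs <;> simp

/-! ### Compactness in `ℓ₂` -/

theorem tendsto_norm_tail (x : Ell2) : Tendsto (fun k => ‖tail k x‖) atTop (𝓝 0) := by
  rw [Metric.tendsto_atTop]
  intro ε hε
  have h := lp.hasSum_single (by norm_num) x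
  rw [HasSum, SummationFilter.unconditional_filter, Metric.tendsto_atTop] at h
  obtain ⟨s, hs⟩ := h ε hε
  obtain ⟨N, hN⟩ := (s.image fun i => |i|.toNat).exists_le
  refine ⟨N, fun k hk => ?_⟩
  have hsub : s ⊆ Finset.Icc (-(k : ℤ)) (k : ℤ) := fun i hi => by
    have := hN _ (Finset.mem_image_of_mem _ hi)
    rw [mem_Icc_iff_abs]
    omega
  have h2 := hs _ hsub
  have h3 : ∑ i ∈ Finset.Icc (-(k : ℤ)) (k : ℤ), lp.single 2 i (x i) = embed k (restrict k x) := by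
    rw [← Finset.sum_coe_sort]
    rfl
  rw [h3, embed_restrict, dist_eq_norm, sub_sub_cancel_left, norm_neg] at h2
  simpa using h2

/-- Dini's argument: the sets where the `k`-th tail has norm below `ε` are open, increase with `k`
and cover `K`. -/
theorem exists_norm_tail_le_of_isCompact {K : Set Ell2} (hK : IsCompact K) {ε : ℝ} (hε : 0 < ε) :
    ∃ k, ∀ x ∈ K, ‖tail k x‖ ≤ ε := by
  have h := hK.elim_directed_cover (fun k : ℕ => {x | ‖tail k x‖ < ε})
    (fun k => isOpen_lt (by fun_prop) continuous_const)
    (fun x _ => by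
      obtain ⟨k, hk⟩ := ((tendsto_norm_tail x).eventually_lt_const hε).exists
      exact Set.mem_iUnion.mpr ⟨k, hk⟩)
    (Monotone.directed_le fun k l hkl x hx => (norm_tail_anti hkl x).trans_lt hx)
  obtain ⟨k, hk⟩ := h
  exact ⟨k, fun x hx => (hk hx).le⟩

/-- Up to `ε / 2` the set lies in a ball of a finite-dimensional coordinate subspace, and a finite
net of that ball serves for the set. -/
theorem totallyBounded_of_norm_tail {S : Set Ell2} {R : ℝ} (hR : ∀ x ∈ S, ‖x‖ ≤ R)
    (hS : ∀ ε > 0, ∃ k, ∀ x ∈ S, ‖tail k x‖ ≤ ε) : TotallyBounded S := by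
  rw [Metric.totallyBounded_iff]
  intro ε hε
  obtain ⟨k, hk⟩ := hS (ε / 2) (by positivity)
  have hb : TotallyBounded (embed k '' (Metric.closedBall 0 R)) :=
    (isCompact_closedBall (0 : FinSpace k) R).totallyBounded.image
      (isometry_embed k).uniformContinuous
  obtain ⟨t, ht, hcov⟩ := Metric.totallyBounded_iff.mp hb (ε / 2) (by positivity)
  refine ⟨t, ht, fun x hx => ?_⟩
  have hmem : embed k (restrict k x) ∈ embed k '' (Metric.closedBall 0 R) :=
    Set.mem_image_of_mem _ (by simpa using (norm_restrict_le k x).trans (hR x hx))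
  obtain ⟨y, hy, hxy⟩ := Set.mem_iUnion₂.mp (hcov hmem)
  refine Set.mem_iUnion₂.mpr ⟨y, hy, ?_⟩
  rw [Metric.mem_ball, dist_eq_norm] at hxy ⊢
  rw [embed_restrict] at hxy
  calc ‖x - y‖ = ‖(x - tail k x - y) + tail k x‖ := by congr 1; abel
    _ ≤ ‖x - tail k x - y‖ + ‖tail k x‖ := norm_add_le _ _
    _ < ε := by linarith [hk x hx]

end Ell2

/-! ### Global existence for dissipative equations in a Hilbert space -/

section Existence

theorem le_gronwallBound_of_deriv_le {E E' : ℝ → ℝ} {a b κ c : ℝ}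
    (hd : ∀ t ∈ Set.Icc a b, HasDerivWithinAt E (E' t) (Set.Icc a b) t)
    (hb : ∀ t ∈ Set.Icc a b, E' t ≤ κ * E t + c) :
    ∀ t ∈ Set.Icc a b, E t ≤ gronwallBound (E a) κ c (t - a) :=
  le_gronwallBound_of_liminf_deriv_right_le (fun t ht => (hd t ht).continuousWithinAt)
    (fun t ht _ hr => ((hd t ⟨ht.1, ht.2.le⟩).mono_of_mem_nhdsWithin
      (Icc_mem_nhdsGE_of_mem ht)).liminf_right_slope_le hr) le_rfl
    fun t ht => hb t ⟨ht.1, ht.2.le⟩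

theorem le_exp_of_deriv_le {E E' : ℝ → ℝ} {a b κ c : ℝ} (hκ : 0 < κ) (hc : 0 ≤ c)
    (hd : ∀ t ∈ Set.Icc a b, HasDerivWithinAt E (E' t) (Set.Icc a b) t)
    (hb : ∀ t ∈ Set.Icc a b, E' t ≤ -κ * E t + c) :
    ∀ t ∈ Set.Icc a b, E t ≤ E a * Real.exp (-κ * (t - a)) + c / κ := by
  intro t ht
  refine (le_gronwallBound_of_deriv_le hd hb t ht).trans ?_
  rw [gronwallBound_of_K_ne_0 (by linarith : (-κ) ≠ 0)]
  have h1 : c / -κ * (Real.exp (-κ * (t - a)) - 1) =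
      c / κ - c / κ * Real.exp (-κ * (t - a)) := by
    rw [div_neg]; ring
  have h2 : 0 ≤ c / κ * Real.exp (-κ * (t - a)) := by positivity
  simp only [h1]
  linarith

variable {H : Type*} [NormedAddCommGroup H] [InnerProductSpace ℝ H]

/-- By Young's inequality `2 C ‖u‖ ≤ lam ‖u‖ ^ 2 + C ^ 2 / lam`, so half of the damping rate `2 *
lam` of the squared norm absorbs the forcing and the rate `lam` is left. -/
theorem norm_sq_le_of_dissipative {u u' : ℝ → H} {a b lam C : ℝ} (hlam : 0 < lam)
    (hd : ∀ t ∈ Set.Icc a b, HasDerivWithinAt u (u' t) (Set.Icc a b) t)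
    (hb : ∀ t ∈ Set.Icc a b, inner ℝ (u' t) (u t) ≤ -lam * ‖u t‖ ^ 2 + C * ‖u t‖) :
    ∀ t ∈ Set.Icc a b,
      ‖u t‖ ^ 2 ≤ ‖u a‖ ^ 2 * Real.exp (-lam * (t - a)) + C ^ 2 / lam ^ 2 := by
  intro t ht
  have h := le_exp_of_deriv_le (E := fun t => ‖u t‖ ^ 2) (c := C ^ 2 / lam) hlam
    (by positivity) (fun t ht => (hd t ht).norm_sq) (fun t ht => by
      have h1 := hb t ht
      rw [real_inner_comm] at h1
      have h2 : 2 * C * ‖u t‖ ≤ lam * ‖u t‖ ^ 2 + C ^ 2 / lam := by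
        have h3 : lam * ‖u t‖ ^ 2 + C ^ 2 / lam - 2 * C * ‖u t‖ =
            (lam * ‖u t‖ - C) ^ 2 / lam := by
          field_simp; ring
        have : 0 ≤ (lam * ‖u t‖ - C) ^ 2 / lam := by positivity
        linarith
      linarith) t ht
  rwa [div_div, ← sq] at h

variable [CompleteSpace H]

/-- Picard–Lindelöf on a ball of radius `1` about `x`. The point is that `δ` depends on `R` alone
and not on the initial time or the initial value, so that steps of equal length can be concatenated.
-/
theorem exists_local_solution {N : H → H}
    (hLip : ∀ R : ℝ, ∃ K : NNReal, LipschitzOnWith K N (Metric.closedBall 0 R))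
    (g : C(ℝ, H)) {C : ℝ} (hg : ∀ t, ‖g t‖ ≤ C) (R : ℝ) :
    ∃ δ > 0, ∀ (a : ℝ) (x : H), ‖x‖ ≤ R → ∃ u : ℝ → H, u a = x ∧
      ∀ t ∈ Set.Icc a (a + δ), HasDerivWithinAt u (N (u t) + g t) (Set.Icc a (a + δ)) t := by
  obtain ⟨K, hK⟩ := hLip (|R| + 1)
  have hC : 0 ≤ C := (norm_nonneg _).trans (hg 0)
  -- `L` bounds the field on the ball of radius `|R| + 1`, so in time `1 / (L + 1)` a solution
  -- cannot leave the unit ball about `x`.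
  set L : NNReal := ⟨K * (|R| + 1) + ‖N 0‖ + C, by positivity⟩ with hL
  have hL0 : (0 : ℝ) ≤ L := L.2
  refine ⟨1 / ((L : ℝ) + 1), by positivity, fun a x hx => ?_⟩
  have hδ : a ≤ a + 1 / ((L : ℝ) + 1) := by
    have : 0 < 1 / ((L : ℝ) + 1) := by positivity
    linarith
  have hball : Metric.closedBall x ((1 : NNReal) : ℝ) ⊆ Metric.closedBall 0 (|R| + 1) := by
    refine Metric.closedBall_subset_closedBall' ?_
    rw [dist_zero_right, NNReal.coe_one]
    linarith [le_abs_self R]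
  have hP : IsPicardLindelof (fun t y => N y + g t)
      (⟨a, le_rfl, hδ⟩ : Set.Icc a (a + 1 / ((L : ℝ) + 1))) x 1 0 L K := by
    refine ⟨fun t _ => ?_, fun y _ => by fun_prop, fun t _ y hy => ?_, ?_⟩
    · refine LipschitzOnWith.of_dist_le_mul fun y hy z hz => ?_
      rw [dist_add_right]
      exact hK.dist_le_mul y (hball hy) z (hball hz)
    · have h1 := hK.dist_le_mul y (hball hy) 0 (Metric.mem_closedBall_self (by positivity))
      have h2 : ‖y‖ ≤ |R| + 1 := by simpa using hball hy
      rw [dist_zero_right, dist_eq_norm] at h1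
      have h3 : ‖N y‖ ≤ ‖N y - N 0‖ + ‖N 0‖ := by
        simpa using norm_add_le (N y - N 0) (N 0)
      have h4 : (K : ℝ) * ‖y‖ ≤ K * (|R| + 1) := by gcongr
      calc ‖N y + g t‖ ≤ ‖N y‖ + ‖g t‖ := norm_add_le _ _
        _ ≤ K * (|R| + 1) + ‖N 0‖ + C := by linarith [hg t]
    · have h0 : (0 : ℝ) ≤ 1 / ((L : ℝ) + 1) := by positivity
      simp only [add_sub_cancel_left, sub_self, max_eq_left h0, NNReal.coe_one, NNReal.coe_zero,
        sub_zero]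
      rw [mul_one_div, div_le_one (by positivity)]
      linarith
  exact hP.exists_eq_forall_mem_Icc_hasDerivWithinAt₀

/-- Dissipativity confines every solution from `x` to the ball of radius `‖x‖ + C / lam`. Hence the
local step `δ` for this radius can be repeated indefinitely, and uniqueness on that ball makes the
pieces agree. -/
theorem exists_global_solution {N : H → H} {lam : ℝ} (hlam : 0 < lam)
    (hLip : ∀ R : ℝ, ∃ K : NNReal, LipschitzOnWith K N (Metric.closedBall 0 R))
    (hdiss : ∀ x, inner ℝ (N x) x ≤ -lam * ‖x‖ ^ 2)
    (g : C(ℝ, H)) {C : ℝ} (hg : ∀ t, ‖g t‖ ≤ C) (x : H) :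
    ∃ u : ℝ → H, u 0 = x ∧
      ∀ t ≥ (0 : ℝ), HasDerivWithinAt u (N (u t) + g t) (Set.Ici 0) t := by
  set R : ℝ := ‖x‖ + C / lam with hR
  have hC : 0 ≤ C := (norm_nonneg _).trans (hg 0)
  have apriori {b : ℝ} {u : ℝ → H} (h0 : u 0 = x)
      (hu : ∀ t ∈ Set.Icc 0 b, HasDerivWithinAt u (N (u t) + g t) (Set.Icc 0 b) t) :
      ∀ t ∈ Set.Icc 0 b, ‖u t‖ ≤ R := by
    intro t ht
    have h := norm_sq_le_of_dissipative (C := C) hlam hu (fun t _ => by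
      rw [inner_add_left]
      have h1 := real_inner_le_norm (g t) (u t)
      have h2 : ‖g t‖ * ‖u t‖ ≤ C * ‖u t‖ := by gcongr; exact hg t
      linarith [hdiss (u t)]) t ht
    have h1 : Real.exp (-lam * (t - 0)) ≤ 1 := Real.exp_le_one_iff.mpr (by nlinarith [ht.1])
    have h2 : ‖u 0‖ ^ 2 * Real.exp (-lam * (t - 0)) ≤ ‖u 0‖ ^ 2 :=
      mul_le_of_le_one_right (by positivity) h1
    rw [h0] at h2 h
    refine le_of_sq_le_sq ?_ (by positivity)
    have h3 : 0 ≤ ‖x‖ * (C / lam) := by positivity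
    rw [← div_pow] at h
    rw [hR]
    nlinarith
  obtain ⟨δ, hδ, hloc⟩ := exists_local_solution hLip g hg R
  have hstep (m : ℕ) : ∃ u : ℝ → H, u 0 = x ∧ ∀ t ∈ Set.Icc 0 (m * δ),
      HasDerivWithinAt u (N (u t) + g t) (Set.Icc 0 (m * δ)) t := by
    induction m with
    | zero =>
      refine ⟨fun _ => x, rfl, fun t ht => ?_⟩
      simp only [Nat.cast_zero, zero_mul, Set.Icc_self]
      exact HasFDerivWithinAt.of_subsingleton Set.subsingleton_singleton
    | succ m ih =>
      obtain ⟨u, h0, hu⟩ := ih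
      have hm : (0 : ℝ) ≤ m * δ := by positivity
      obtain ⟨w, hw0, hw⟩ := hloc (m * δ) (u (m * δ)) (apriori h0 hu _ ⟨hm, le_rfl⟩)
      have heq : ((m + 1 : ℕ) : ℝ) * δ = m * δ + δ := by push_cast; ring
      have hset : Set.Icc (0 : ℝ) (m * δ + δ) =
          Set.Icc 0 (m * δ) ∪ Set.Icc (m * δ) (m * δ + δ) :=
        (Set.Icc_union_Icc_eq_Icc hm (by linarith)).symm
      set z : ℝ → H := fun t => if t ≤ m * δ then u t else w t with hz
      have hzu : ∀ t ∈ Set.Icc 0 (m * δ), z t = u t := fun t ht => if_pos ht.2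
      have hzw : ∀ t ∈ Set.Icc (m * δ) (m * δ + δ), z t = w t := fun t ht => by
        by_cases h : t ≤ m * δ
        · have : t = m * δ := le_antisymm h ht.1
          subst this
          simp [hz, hw0]
        · exact if_neg h
      refine ⟨z, by rw [hzu 0 ⟨le_rfl, hm⟩, h0], fun t ht => ?_⟩
      rw [heq, hset] at *
      refine HasDerivWithinAt.union ?_ ?_
      · by_cases h : t ≤ m * δ
        · have hmem : t ∈ Set.Icc 0 (m * δ) := ⟨by
            rcases ht with ht | ht
            exacts [ht.1, hm.trans ht.1], h⟩
          rw [hzu t hmem]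
          exact (hu t hmem).congr hzu (hzu t hmem)
        · refine HasFDerivWithinAt.of_notMem_closure ?_
          rw [isClosed_Icc.closure_eq]
          exact fun h' => h h'.2
      · by_cases h : m * δ ≤ t
        · have hmem : t ∈ Set.Icc (m * δ) (m * δ + δ) := ⟨h, by
            rcases ht with ht | ht
            exacts [by linarith [ht.2], ht.2]⟩
          rw [hzw t hmem]
          exact (hw t hmem).congr hzw (hzw t hmem)
        · refine HasFDerivWithinAt.of_notMem_closure ?_
          rw [isClosed_Icc.closure_eq]
          exact fun h' => h h'.1
  choose u hu0 hu using hstep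
  have huniq {m l : ℕ} (hml : m ≤ l) {t : ℝ} (ht : t ∈ Set.Icc 0 (m * δ)) : u m t = u l t := by
    obtain ⟨K, hK⟩ := hLip R
    have hle : (m : ℝ) * δ ≤ l * δ := by gcongr
    have hsub : Set.Icc 0 (m * δ) ⊆ Set.Icc 0 (l * δ) := Set.Icc_subset_Icc le_rfl hle
    have hl : ∀ t ∈ Set.Icc 0 (m * δ),
        HasDerivWithinAt (u l) (N (u l t) + g t) (Set.Icc 0 (m * δ)) t :=
      fun t ht => (hu l t (hsub ht)).mono hsub
    have right {w : ℝ → H} (hw : ∀ t ∈ Set.Icc 0 (m * δ),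
        HasDerivWithinAt w (N (w t) + g t) (Set.Icc 0 (m * δ)) t) :
        ∀ t ∈ Set.Ico 0 (m * δ), HasDerivWithinAt w (N (w t) + g t) (Set.Ici t) t :=
      fun t ht => (hw t ⟨ht.1, ht.2.le⟩).mono_of_mem_nhdsWithin (Icc_mem_nhdsGE_of_mem ht)
    have h := dist_le_of_trajectories_ODE_of_mem (v := fun t y => N y + g t) (K := K)
      (s := fun _ => Metric.closedBall 0 R) (δ := 0) (f := u m) (g := u l)
      (fun t _ => LipschitzOnWith.of_dist_le_mul fun y hy z hz => by
        rw [dist_add_right]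
        exact hK.dist_le_mul y hy z hz)
      (fun t ht => (hu m t ht).continuousWithinAt) (right (hu m))
      (fun t ht => by simpa using apriori (hu0 m) (hu m) t ⟨ht.1, ht.2.le⟩)
      (fun t ht => (hl t ht).continuousWithinAt) (right hl)
      (fun t ht => by simpa using apriori (hu0 l) hl t ⟨ht.1, ht.2.le⟩)
      (by rw [hu0, hu0, dist_self]) t ht
    rw [zero_mul] at h
    exact dist_le_zero.mp h
  -- The extra `1` puts `t` strictly below the right endpoint, so that the derivative within the
  -- interval is one within `[0, ∞)`.
  set idx : ℝ → ℕ := fun t => ⌈t / δ⌉₊ + 1 with hidx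
  have hlt (t : ℝ) : t < idx t * δ := by
    rw [← div_lt_iff₀ hδ]
    have := Nat.le_ceil (t / δ)
    simp only [hidx, Nat.cast_add, Nat.cast_one]
    linarith
  refine ⟨fun t => u (idx t) t, hu0 _, fun t ht => ?_⟩
  have hagree : ∀ s ∈ Set.Icc 0 (idx t * δ), u (idx s) s = u (idx t) s := fun s hs => by
    rcases le_total (idx s) (idx t) with h | h
    · exact huniq h ⟨hs.1, (hlt s).le⟩
    · exact (huniq h hs).symm
  have hmem : t ∈ Set.Icc 0 (idx t * δ) := ⟨ht, (hlt t).le⟩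
  refine ((hu (idx t) t hmem).congr hagree rfl).mono_of_mem_nhdsWithin ?_
  rw [← Set.Ici_inter_Iic]
  exact inter_mem_nhdsWithin _ (Iic_mem_nhds (hlt t))

end Existence

/-! ### The discrete Laplacian attached to a permutation of the index set -/

section Laplacian

variable {ι : Type*} (s : Equiv.Perm ι)

theorem summable_weighted_laplacian {θ x : ι → ℝ} (h0 : ∀ i, 0 ≤ θ i) (h1 : ∀ i, θ i ≤ 1)
    (hx : Summable fun i => x i ^ 2) :
    Summable fun i => θ i * x i * (x (s.symm i) - 2 * x i + x (s i)) := by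
  have hs : Summable fun i => x (s i) ^ 2 :=
    (s.summable_iff (f := fun i => x i ^ 2)).mpr hx
  have hs' : Summable fun i => x (s.symm i) ^ 2 :=
    (s.symm.summable_iff (f := fun i => x i ^ 2)).mpr hx
  refine Summable.of_norm_bounded ((hs.add hs').add (hx.mul_left 3)) fun i => ?_
  rw [Real.norm_eq_abs, abs_mul, abs_mul, abs_of_nonneg (h0 i)]
  have h2 : |x (s.symm i) - 2 * x i + x (s i)| ≤ |x (s.symm i)| + 2 * |x i| + |x (s i)| := by
    refine (abs_add_le _ _).trans (add_le_add_left ((abs_sub _ _).trans ?_) _)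
    rw [abs_mul, abs_two]
  have h3 : θ i * |x i| ≤ |x i| := mul_le_of_le_one_left (abs_nonneg _) (h1 i)
  rw [← sq_abs (x (s i)), ← sq_abs (x (s.symm i)), ← sq_abs (x i)]
  calc θ i * |x i| * |x (s.symm i) - 2 * x i + x (s i)|
      ≤ |x i| * (|x (s.symm i)| + 2 * |x i| + |x (s i)|) := by gcongr
    _ ≤ _ := by nlinarith [sq_nonneg (|x i| - |x (s i)|), sq_nonneg (|x i| - |x (s.symm i)|),
        sq_nonneg |x (s i)|, sq_nonneg |x (s.symm i)|]

/-- Bound the cross terms by `2 x y ≤ x ^ 2 + y ^ 2`, move the weight from `i` to its neighbour at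
the cost `δ`, and reindex by `s`: the weighted sums cancel. Working with a permutation covers both
`ℤ` and the periodic index set; `θ = 1`, `δ = 0` gives dissipativity of the Laplacian. -/
theorem tsum_weighted_laplacian_le {θ x : ι → ℝ} {δ : ℝ} (h0 : ∀ i, 0 ≤ θ i) (h1 : ∀ i, θ i ≤ 1)
    (hδ : ∀ i, |θ i - θ (s i)| ≤ δ) (hx : Summable fun i => x i ^ 2) :
    ∑' i, θ i * x i * (x (s.symm i) - 2 * x i + x (s i)) ≤ δ * ∑' i, x i ^ 2 := by
  have hX := hx.hasSum
  have hw : Summable fun i => θ i * x i ^ 2 := hx.of_nonneg_of_le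
    (fun i => mul_nonneg (h0 i) (sq_nonneg _))
    fun i => mul_le_of_le_one_left (sq_nonneg _) (h1 i)
  have hW := hw.hasSum
  have e1 : HasSum (fun i => x (s i) ^ 2) (∑' i, x i ^ 2) :=
    (s.hasSum_iff (f := fun i => x i ^ 2)).mpr hX
  have e2 : HasSum (fun i => x (s.symm i) ^ 2) (∑' i, x i ^ 2) :=
    (s.symm.hasSum_iff (f := fun i => x i ^ 2)).mpr hX
  have e3 : HasSum (fun i => θ (s i) * x (s i) ^ 2) (∑' i, θ i * x i ^ 2) :=
    (s.hasSum_iff (f := fun i => θ i * x i ^ 2)).mpr hW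
  have e4 : HasSum (fun i => θ (s.symm i) * x (s.symm i) ^ 2) (∑' i, θ i * x i ^ 2) :=
    (s.symm.hasSum_iff (f := fun i => θ i * x i ^ 2)).mpr hW
  have hU := (((e3.add e4).mul_left (1 / 2)).sub hW).add ((e1.add e2).mul_left (δ / 2))
  have hle (i : ι) : θ i * x i * (x (s.symm i) - 2 * x i + x (s i)) ≤
      1 / 2 * (θ (s i) * x (s i) ^ 2 + θ (s.symm i) * x (s.symm i) ^ 2) - θ i * x i ^ 2 +
        δ / 2 * (x (s i) ^ 2 + x (s.symm i) ^ 2) := by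
    have a1 := abs_le.mp (hδ i)
    have a2 := abs_le.mp (hδ (s.symm i))
    rw [Equiv.apply_symm_apply] at a2
    generalize x (s i) = y at *
    generalize x (s.symm i) = z at *
    generalize x i = w at *
    generalize θ (s i) = α at *
    generalize θ (s.symm i) = β at *
    have b0 := h0 i
    generalize θ i = γ at *
    have b1 : γ * y ^ 2 ≤ (α + δ) * y ^ 2 :=
      mul_le_mul_of_nonneg_right (by linarith) (sq_nonneg _)
    have b2 : γ * z ^ 2 ≤ (β + δ) * z ^ 2 :=
      mul_le_mul_of_nonneg_right (by linarith) (sq_nonneg _)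
    have b3 : 0 ≤ γ * (w - y) ^ 2 := mul_nonneg b0 (sq_nonneg _)
    have b4 : 0 ≤ γ * (w - z) ^ 2 := mul_nonneg b0 (sq_nonneg _)
    linarith
  calc _ ≤ _ := hasSum_le hle (summable_weighted_laplacian s h0 h1 hx).hasSum hU
    _ = _ := by ring

/-- Used with `a = x`, `c = F(x)` to see that the lattice field takes values in `ℓ₂`, and with `a =
x - y`, `c = F(x) - F(y)` for the local Lipschitz bounds of both fields. -/
theorem summable_field_sq {a c : ι → ℝ} {ν lam L : ℝ} (hν : 0 ≤ ν) (hlam : 0 ≤ lam) (hL : 0 ≤ L)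
    (hc : ∀ i, |c i| ≤ L * |a i|) (ha : Summable fun i => a i ^ 2) :
    (Summable fun i => (ν * (a (s.symm i) - 2 * a i + a (s i)) - lam * a i + c i) ^ 2) ∧
      ∑' i, (ν * (a (s.symm i) - 2 * a i + a (s i)) - lam * a i + c i) ^ 2 ≤
        (3 * (2 * ν + lam + L)) ^ 2 * ∑' i, a i ^ 2 := by
  set κ := 2 * ν + lam + L with hκ
  have hX := ha.hasSum
  have e1 : HasSum (fun i => a (s i) ^ 2) (∑' i, a i ^ 2) :=
    (s.hasSum_iff (f := fun i => a i ^ 2)).mpr hX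
  have e2 : HasSum (fun i => a (s.symm i) ^ 2) (∑' i, a i ^ 2) :=
    (s.symm.hasSum_iff (f := fun i => a i ^ 2)).mpr hX
  have hU := ((e1.add e2).add hX).mul_left (3 * κ ^ 2)
  have hle (i : ι) : (ν * (a (s.symm i) - 2 * a i + a (s i)) - lam * a i + c i) ^ 2 ≤
      3 * κ ^ 2 * (a (s i) ^ 2 + a (s.symm i) ^ 2 + a i ^ 2) := by
    have h1 : |ν * (a (s.symm i) - 2 * a i + a (s i)) - lam * a i + c i| ≤
        κ * (|a (s i)| + |a (s.symm i)| + |a i|) := by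
      have hci := abs_le.mp (hc i)
      have p1 := abs_nonneg (a (s i))
      have p2 := abs_nonneg (a (s.symm i))
      have p3 := abs_nonneg (a i)
      have q1 := mul_le_mul_of_nonneg_left (le_abs_self (a (s i))) hν
      have q2 := mul_le_mul_of_nonneg_left (le_abs_self (a (s.symm i))) hν
      have q3 := mul_le_mul_of_nonneg_left (le_abs_self (a i)) hν
      have q1' := mul_le_mul_of_nonneg_left (neg_abs_le (a (s i))) hν
      have q2' := mul_le_mul_of_nonneg_left (neg_abs_le (a (s.symm i))) hν
      have q3' := mul_le_mul_of_nonneg_left (neg_abs_le (a i)) hν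
      have q4 := mul_le_mul_of_nonneg_left (le_abs_self (a i)) hlam
      have q4' := mul_le_mul_of_nonneg_left (neg_abs_le (a i)) hlam
      have r1 := mul_nonneg hν p1
      have r2 := mul_nonneg hν p2
      have r3 := mul_nonneg hν p3
      have r4 := mul_nonneg hlam p1
      have r5 := mul_nonneg hlam p2
      have r6 := mul_nonneg hL p1
      have r7 := mul_nonneg hL p2
      rw [hκ, abs_le]
      constructor <;> linarith
    rw [← sq_abs (ν * _ - _ + _), ← sq_abs (a (s i)), ← sq_abs (a (s.symm i)), ← sq_abs (a i)]
    calc _ ≤ (κ * (|a (s i)| + |a (s.symm i)| + |a i|)) ^ 2 := by gcongr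
      _ = κ ^ 2 * (|a (s i)| + |a (s.symm i)| + |a i|) ^ 2 := mul_pow _ _ _
      _ ≤ κ ^ 2 * (3 * (|a (s i)| ^ 2 + |a (s.symm i)| ^ 2 + |a i| ^ 2)) := by
        gcongr
        nlinarith [sq_nonneg (|a (s i)| - |a (s.symm i)|), sq_nonneg (|a (s i)| - |a i|),
          sq_nonneg (|a (s.symm i)| - |a i|)]
      _ = _ := by ring
  have hsum := hU.summable.of_nonneg_of_le (fun i => sq_nonneg _) hle
  exact ⟨hsum, (hasSum_le hle hsum.hasSum hU).trans (le_of_eq (by ring))⟩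

end Laplacian

/-- The translation `i ↦ i + 1` of `ℤ`. -/
def intSucc : Equiv.Perm ℤ where
  toFun i := i + 1
  invFun i := i - 1
  left_inv i := by simp
  right_inv i := by simp

theorem cyclicSucc_coe {n : ℕ} (i : Idx n) :
    (cyclicSucc i : ℤ) = if (i : ℤ) = n then -(n : ℤ) else i + 1 := by
  unfold cyclicSucc
  split_ifs <;> rfl

theorem cyclicPred_coe {n : ℕ} (i : Idx n) :
    (cyclicPred i : ℤ) = if (i : ℤ) = -(n : ℤ) then (n : ℤ) else i - 1 := by
  unfold cyclicPred
  split_ifs <;> rfl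

/-- The cyclic rotation of `{-n, …, n}`. -/
def cyclicPerm (n : ℕ) : Equiv.Perm (Idx n) where
  toFun := cyclicSucc
  invFun := cyclicPred
  left_inv i := by
    have := Finset.mem_Icc.mp i.2
    ext
    rw [cyclicPred_coe, cyclicSucc_coe]
    split_ifs <;> omega
  right_inv i := by
    have := Finset.mem_Icc.mp i.2
    ext
    rw [cyclicSucc_coe, cyclicPred_coe]
    split_ifs <;> omega

/-! ### The vector fields and the cocycles -/

section Cocycles

variable {ν lam : ℝ} {F : ℝ → ℝ}

/-- Local Lipschitz continuity of `F` with constants on symmetric intervals. -/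
def IsLocLip (F : ℝ → ℝ) : Prop :=
  ∀ R : ℝ, ∃ L : ℝ, 0 ≤ L ∧ ∀ s t, |s| ≤ R → |t| ≤ R → |F s - F t| ≤ L * |s - t|

theorem IsLocLip.abs_le (hFL : IsLocLip F) (hF0 : F 0 = 0) (R : ℝ) :
    ∃ L : ℝ, 0 ≤ L ∧ (∀ s t, |s| ≤ R → |t| ≤ R → |F s - F t| ≤ L * |s - t|) ∧
      ∀ s, |s| ≤ R → |F s| ≤ L * |s| := by
  obtain ⟨L, hL, h⟩ := hFL R
  refine ⟨L, hL, h, fun s hs => ?_⟩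
  simpa [hF0] using h s 0 hs (by simpa using (abs_nonneg s).trans hs)

theorem exists_latticeField (hν : 0 ≤ ν) (hlam : 0 ≤ lam) (hFL : IsLocLip F) (hF0 : F 0 = 0)
    (hF : ∀ s, F s * s ≤ 0) :
    ∃ N : Ell2 → Ell2,
      (∀ x i, N x i = ν * (x (i - 1) - 2 * x i + x (i + 1)) - lam * x i + F (x i)) ∧
      (∀ R : ℝ, ∃ K : NNReal, LipschitzOnWith K N (Metric.closedBall 0 R)) ∧
      ∀ x, inner ℝ (N x) x ≤ -lam * ‖x‖ ^ 2 := by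
  have hsum (x : Ell2) : Summable fun i =>
      (ν * (x (i - 1) - 2 * x i + x (i + 1)) - lam * x i + F (x i)) ^ 2 := by
    obtain ⟨L, hL, -, hc⟩ := hFL.abs_le hF0 ‖x‖
    exact (summable_field_sq intSucc hν hlam hL (fun i => hc _ (abs_apply_le x i))
      (summable_sq x)).1
  refine ⟨fun x => ofSummable _ (hsum x), fun x i => rfl, fun R => ?_, fun x => ?_⟩
  · obtain ⟨L, hL, hc, -⟩ := hFL.abs_le hF0 R
    refine ⟨(3 * (2 * ν + lam + L)).toNNReal, LipschitzOnWith.of_dist_le_mul ?_⟩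
    intro x hx y hy
    rw [mem_closedBall_zero_iff] at hx hy
    rw [dist_eq_norm, dist_eq_norm, Real.coe_toNNReal _ (by positivity)]
    refine le_of_sq_le_sq ?_ (by positivity)
    rw [mul_pow, norm_sq_eq, norm_sq_eq]
    have h := (summable_field_sq (a := fun i => (x - y) i) (c := fun i => F (x i) - F (y i))
      intSucc hν hlam hL
      (fun i => hc _ _ ((abs_apply_le x i).trans hx) ((abs_apply_le y i).trans hy))
      (summable_sq (x - y))).2
    refine le_trans (le_of_eq (tsum_congr fun i => ?_)) h
    simp only [lp.coeFn_sub, Pi.sub_apply, ofSummable_apply, intSucc, Equiv.coe_fn_mk,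
      Equiv.coe_fn_symm_mk]
    ring
  · rw [inner_eq, norm_sq_eq, ← tsum_mul_left]
    have h1 := tsum_weighted_laplacian_le (θ := fun _ => 1) (δ := 0) intSucc (fun _ => zero_le_one)
      (fun _ => le_rfl) (by simp) (summable_sq x)
    have h2 := summable_weighted_laplacian (θ := fun _ => 1) intSucc (fun _ => zero_le_one)
      (fun _ => le_rfl) (summable_sq x)
    rw [zero_mul] at h1
    have h3 := (summable_sq x).mul_left (-lam)
    have h4 := (h2.mul_left ν).add h3
    refine (Summable.tsum_le_tsum (fun i => ?_) (summable_mul (ofSummable _ (hsum x)) x) h4).trans ?_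
    · simp only [ofSummable_apply, intSucc, Equiv.coe_fn_mk, Equiv.coe_fn_symm_mk]
      linarith [hF (x i)]
    · rw [(h2.mul_left ν).tsum_add h3, tsum_mul_left]
      nlinarith

theorem inner_eq_finSpace {n : ℕ} (v w : FinSpace n) : inner ℝ v w = ∑ i, v i * w i := by
  simp [PiLp.inner_apply, mul_comm]

theorem finField_lipschitz (hν : 0 ≤ ν) (hlam : 0 ≤ lam) (hFL : IsLocLip F) (hF0 : F 0 = 0)
    (n : ℕ) (R : ℝ) :
    ∃ K : NNReal, LipschitzOnWith K (finField ν lam F (0 : FinSpace n)) (Metric.closedBall 0 R) := by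
  obtain ⟨L, hL, hc, -⟩ := hFL.abs_le hF0 R
  refine ⟨(3 * (2 * ν + lam + L)).toNNReal, LipschitzOnWith.of_dist_le_mul ?_⟩
  intro x hx y hy
  rw [mem_closedBall_zero_iff] at hx hy
  rw [dist_eq_norm, dist_eq_norm, Real.coe_toNNReal _ (by positivity)]
  refine le_of_sq_le_sq ?_ (by positivity)
  rw [mul_pow, norm_sq_finSpace, norm_sq_finSpace]
  have hcoord (v : FinSpace n) (i : Idx n) : |v i| ≤ ‖v‖ := by
    simpa using PiLp.norm_apply_le v i
  have h := (summable_field_sq (a := fun i => (x - y) i) (c := fun i => F (x i) - F (y i))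
    (cyclicPerm n) hν hlam hL
    (fun i => hc _ _ ((hcoord x i).trans hx) ((hcoord y i).trans hy)) (Summable.of_finite)).2
  rw [tsum_fintype, tsum_fintype] at h
  refine le_trans (le_of_eq (Finset.sum_congr rfl fun i _ => ?_)) h
  simp only [finField, PiLp.sub_apply, PiLp.zero_apply, cyclicPerm, Equiv.coe_fn_mk,
    Equiv.coe_fn_symm_mk]
  ring

theorem inner_finField_le (hν : 0 ≤ ν) (hF : ∀ s, F s * s ≤ 0) {n : ℕ} (v : FinSpace n) :
    inner ℝ (finField ν lam F 0 v) v ≤ -lam * ‖v‖ ^ 2 := by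
  rw [inner_eq_finSpace, norm_sq_finSpace, Finset.mul_sum]
  have h1 := tsum_weighted_laplacian_le (θ := fun _ => 1) (x := fun i => v i) (δ := 0)
    (cyclicPerm n) (fun _ => zero_le_one) (fun _ => le_rfl) (by simp) Summable.of_finite
  rw [zero_mul, tsum_fintype] at h1
  have h2 := mul_nonpos_of_nonneg_of_nonpos hν h1
  rw [Finset.mul_sum] at h2
  refine le_trans (Finset.sum_le_sum fun i _ => ?_)
    ((Finset.sum_add_distrib (f := fun i => ν * _)).trans_le (add_le_of_nonpos_left h2))
  simp only [finField, PiLp.zero_apply, cyclicPerm, Equiv.coe_fn_mk, Equiv.coe_fn_symm_mk]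
  linarith [hF (v i)]

theorem finField_eq_add {n : ℕ} (b v : FinSpace n) :
    finField ν lam F b v = finField ν lam F 0 v + b := by
  ext i
  simp [finField]

/-- Existence alone settles the chosen value: the later estimates hold for every solution. -/
theorem latticeCocycle_spec (hν : 0 ≤ ν) (hlam : 0 < lam) (hFL : IsLocLip F) (hF0 : F 0 = 0)
    (hF : ∀ s, F s * s ≤ 0) {g : C(ℝ, Ell2)} {C : ℝ} (hg : ∀ t, ‖g t‖ ≤ C) (x : Ell2) :
    IsLatticeSolution ν lam F g (fun t => latticeCocycle ν lam F t x g) ∧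
      latticeCocycle ν lam F 0 x g = x := by
  have h : ∃ u : ℝ → Ell2, IsLatticeSolution ν lam F g u ∧ u 0 = x := by
    obtain ⟨N, hN, hLip, hdiss⟩ := exists_latticeField hν hlam.le hFL hF0 hF
    obtain ⟨u, hu0, hu⟩ := exists_global_solution hlam hLip hdiss g hg x
    exact ⟨u, fun t ht => ⟨N (u t) + g t, fun i => by
      rw [lp.coeFn_add, Pi.add_apply, hN], hu t ht⟩, hu0⟩
  have heq : (fun t => latticeCocycle ν lam F t x g) = h.choose := by
    funext t
    exact dif_pos h
  refine ⟨heq ▸ h.choose_spec.1, ?_⟩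
  exact (congrFun heq 0).trans h.choose_spec.2

theorem finCocycle_spec (hν : 0 ≤ ν) (hlam : 0 < lam) (hFL : IsLocLip F) (hF0 : F 0 = 0)
    (hF : ∀ s, F s * s ≤ 0) {n : ℕ} {g : C(ℝ, FinSpace n)} {C : ℝ} (hg : ∀ t, ‖g t‖ ≤ C)
    (x : FinSpace n) :
    IsFinSolution ν lam F g (fun t => finCocycle ν lam F n t x g) ∧
      finCocycle ν lam F n 0 x g = x := by
  have h : ∃ v : ℝ → FinSpace n, IsFinSolution ν lam F g v ∧ v 0 = x := by
    obtain ⟨u, hu0, hu⟩ := exists_global_solution hlam (finField_lipschitz hν hlam.le hFL hF0 n)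
      (inner_finField_le hν hF) g hg x
    exact ⟨u, fun t ht => by rw [finField_eq_add]; exact hu t ht, hu0⟩
  have heq : (fun t => finCocycle ν lam F n t x g) = h.choose := by
    funext t
    exact dif_pos h
  refine ⟨heq ▸ h.choose_spec.1, ?_⟩
  exact (congrFun heq 0).trans h.choose_spec.2

end Cocycles

/-! ### Ramp weights -/

section Ramp

/-- The weight `min (|i| / k) 1`. -/
def ramp (k : ℕ) (i : ℤ) : ℝ := min (((|i| : ℤ) : ℝ) / k) 1

theorem ramp_nonneg (k : ℕ) (i : ℤ) : 0 ≤ ramp k i := le_min (by positivity) zero_le_one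

theorem ramp_le_one (k : ℕ) (i : ℤ) : ramp k i ≤ 1 := min_le_right _ _

theorem abs_ramp_le_one (k : ℕ) (i : ℤ) : |ramp k i| ≤ 1 := by
  rw [abs_of_nonneg (ramp_nonneg k i)]
  exact ramp_le_one k i

theorem ramp_eq_one {k : ℕ} (hk : 1 ≤ k) {i : ℤ} (h : (k : ℤ) < |i|) : ramp k i = 1 := by
  refine min_eq_right ?_
  have hk' : (0 : ℝ) < k := by exact_mod_cast hk
  rw [le_div_iff₀ hk', one_mul]
  exact_mod_cast h.le

theorem ramp_le {k m : ℕ} {i : ℤ} (h : |i| ≤ m) : ramp k i ≤ m / k := by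
  refine (min_le_left _ _).trans ?_
  gcongr
  exact_mod_cast h

theorem abs_ramp_sub_le {k : ℕ} {i j : ℤ} (h : |(|i| - |j|)| ≤ 1) :
    |ramp k i - ramp k j| ≤ 1 / k := by
  refine (abs_min_sub_min_le_max _ _ _ _).trans ?_
  rw [sub_self, abs_zero, max_eq_left (abs_nonneg _), ← sub_div, abs_div, Nat.abs_cast]
  gcongr
  exact_mod_cast h

/-- Split at `m`: beyond `m` the weight is at most `1`, and up to `m` it is at most `m / k`. Thus a
small `m`-tail and a large `k` make the weighted norm small. -/
theorem norm_ramp_mul_le (k m : ℕ) (x : Ell2) :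
    ‖mulOp (ramp k) (abs_ramp_le_one k) x‖ ≤ ‖tail m x‖ + m / k * ‖x‖ := by
  set T := mulOp (ramp k) (abs_ramp_le_one k)
  have h1 : T x = T (tail m x) + T (x - tail m x) := by rw [← map_add]; congr 1; abel
  have h2 : ‖T (x - tail m x)‖ ≤ ‖((m : ℝ) / k) • x‖ := by
    refine norm_le_of_abs_le fun i => ?_
    rw [mulOp_apply, lp.coeFn_sub, Pi.sub_apply, tail_apply, lp.coeFn_smul, Pi.smul_apply,
      smul_eq_mul, abs_mul, abs_mul, abs_of_nonneg (ramp_nonneg k i),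
      abs_of_nonneg (by positivity : (0 : ℝ) ≤ m / k)]
    split_ifs with h
    · rw [sub_self, abs_zero, mul_zero]
      positivity
    · rw [sub_zero]
      gcongr
      exact ramp_le (not_lt.mp h)
  rw [norm_smul, Real.norm_of_nonneg (by positivity)] at h2
  rw [h1]
  exact (norm_add_le _ _).trans (add_le_add (norm_mulOp_le _ _ _) h2)

theorem norm_tail_sq_le_inner {k : ℕ} (hk : 1 ≤ k) (x : Ell2) :
    ‖tail k x‖ ^ 2 ≤ inner ℝ (mulOp (ramp k) (abs_ramp_le_one k) x) x := by
  rw [norm_sq_eq, inner_eq]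
  refine (summable_sq _).tsum_le_tsum (fun i => ?_) (summable_mul _ _)
  rw [tail_apply, mulOp_apply]
  split_ifs with h
  · rw [ramp_eq_one hk h, one_mul, sq]
  · have := mul_nonneg (ramp_nonneg k i) (mul_self_nonneg (x i))
    linarith

theorem inner_mulOp_comm (θ : ℤ → ℝ) (hθ : ∀ i, |θ i| ≤ 1) (x y : Ell2) :
    inner ℝ (mulOp θ hθ x) y = inner ℝ x (mulOp θ hθ y) := by
  rw [inner_eq, inner_eq]
  exact tsum_congr fun i => by rw [mulOp_apply, mulOp_apply]; ring

theorem exists_div_le (D : ℝ) {ε : ℝ} (hε : 0 < ε) (k₀ : ℕ) : ∃ k : ℕ, k₀ ≤ k ∧ 1 ≤ k ∧ D / k ≤ ε := by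
  obtain ⟨k, hk⟩ := exists_nat_gt (D / ε)
  refine ⟨max k (max k₀ 1), by omega, by omega, ?_⟩
  have h1 : (0 : ℝ) < (max k (max k₀ 1) : ℕ) := by
    have : 0 < max k (max k₀ 1) := by omega
    exact_mod_cast this
  rw [div_le_iff₀ h1]
  rw [div_lt_iff₀ hε] at hk
  have h2 : (k : ℝ) ≤ (max k (max k₀ 1) : ℕ) := by exact_mod_cast le_max_left _ _
  nlinarith

theorem exists_exp_le {A κ ε : ℝ} (hκ : 0 < κ) (hε : 0 < ε) (t₀ : ℝ) :
    ∃ T : ℝ, t₀ ≤ T ∧ 0 ≤ T ∧ ∀ t ≥ T, A * Real.exp (-κ * (t - t₀)) ≤ ε := by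
  have h : Tendsto (fun t : ℝ => A * Real.exp (-κ * (t - t₀))) atTop (𝓝 (A * 0)) := by
    refine (Real.tendsto_exp_atBot.comp ?_).const_mul A
    exact (tendsto_atTop_add_const_right _ _ tendsto_id).const_mul_atTop_of_neg (by linarith)
  rw [mul_zero] at h
  obtain ⟨T, hT⟩ := eventually_atTop.mp (h.eventually_le_const hε)
  exact ⟨max T (max t₀ 0), by simp, by simp, fun t ht => hT t ((le_max_left _ _).trans ht)⟩

end Ramp

/-! ### A priori estimates -/

section Energy

variable {ν lam : ℝ} {F : ℝ → ℝ}

theorem lattice_norm_sq_le (hν : 0 ≤ ν) (hlam : 0 < lam) (hFL : IsLocLip F) (hF0 : F 0 = 0)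
    (hF : ∀ s, F s * s ≤ 0) {g : C(ℝ, Ell2)} {C : ℝ} (hg : ∀ t, ‖g t‖ ≤ C) {u : ℝ → Ell2}
    (hu : IsLatticeSolution ν lam F g u) {t : ℝ} (ht : 0 ≤ t) :
    ‖u t‖ ^ 2 ≤ ‖u 0‖ ^ 2 * Real.exp (-lam * (t - 0)) + C ^ 2 / lam ^ 2 := by
  obtain ⟨N, hN, -, hdiss⟩ := exists_latticeField hν hlam.le hFL hF0 hF
  choose! w hw hd using hu
  refine norm_sq_le_of_dissipative (u' := w) hlam
    (fun s hs => (hd s hs.1).mono Set.Icc_subset_Ici_self) (fun s hs => ?_) t ⟨ht, le_rfl⟩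
  have hws : w s = N (u s) + g s := by
    ext i
    rw [hw s hs.1, lp.coeFn_add, Pi.add_apply, hN]
  rw [hws, inner_add_left]
  have h1 := real_inner_le_norm (g s) (u s)
  have h2 : ‖g s‖ * ‖u s‖ ≤ C * ‖u s‖ := by gcongr; exact hg s
  linarith [hdiss (u s)]

theorem fin_norm_sq_le (hν : 0 ≤ ν) (hlam : 0 < lam)
    (hF : ∀ s, F s * s ≤ 0) {n : ℕ} {g : C(ℝ, FinSpace n)} {C : ℝ} (hg : ∀ t, ‖g t‖ ≤ C)
    {v : ℝ → FinSpace n} (hv : IsFinSolution ν lam F g v) {t : ℝ} (ht : 0 ≤ t) :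
    ‖v t‖ ^ 2 ≤ ‖v 0‖ ^ 2 * Real.exp (-lam * (t - 0)) + C ^ 2 / lam ^ 2 := by
  refine norm_sq_le_of_dissipative hlam
    (fun s hs => (hv s hs.1).mono Set.Icc_subset_Ici_self) (fun s hs => ?_) t ⟨ht, le_rfl⟩
  rw [finField_eq_add, inner_add_left]
  have h1 := real_inner_le_norm (g s) (v s)
  have h2 : ‖g s‖ * ‖v s‖ ≤ C * ‖v s‖ := by gcongr; exact hg s
  linarith [inner_finField_le (lam := lam) hν hF (v s)]

/-- The entrance time into the ball of radius `C / lam + 1` is uniform on bounded sets. -/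
theorem exists_absorbing_time (hlam : 0 < lam) {C : ℝ} (hC : 0 ≤ C) (ρ : ℝ) :
    ∃ T : ℝ, 0 ≤ T ∧ ∀ t ≥ T, ∀ a b : ℝ, 0 ≤ a → a ≤ ρ → 0 ≤ b →
      b ^ 2 ≤ a ^ 2 * Real.exp (-lam * (t - 0)) + C ^ 2 / lam ^ 2 → b ≤ C / lam + 1 := by
  obtain ⟨T, -, hT0, hT⟩ := exists_exp_le (A := ρ ^ 2) hlam zero_lt_one 0
  refine ⟨T, hT0, fun t ht a b ha hab hb h => le_of_sq_le_sq ?_ (by positivity)⟩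
  have h1 : a ^ 2 * Real.exp (-lam * (t - 0)) ≤ ρ ^ 2 * Real.exp (-lam * (t - 0)) := by gcongr
  have h2 := hT t ht
  have h3 : 0 ≤ C / lam := by positivity
  rw [← div_pow] at h
  nlinarith

theorem le_radius_of_zero (hlam : 0 < lam) {C b t : ℝ} (hC : 0 ≤ C)
    (h : b ^ 2 ≤ (0 : ℝ) ^ 2 * Real.exp (-lam * (t - 0)) + C ^ 2 / lam ^ 2) :
    b ≤ C / lam + 1 := by
  refine le_of_sq_le_sq ?_ (by positivity)
  have h3 : 0 ≤ C / lam := by positivity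
  rw [← div_pow] at h
  nlinarith

/-- Gronwall for the energy with weight `ramp k`. The slope `1 / k` of the ramp bounds the
contribution of the Laplacian, the nonlinearity drops out by its sign, and the damping gives the
rate `2 * lam`. -/
theorem lattice_tail_sq_le (hν : 0 ≤ ν) (hlam : 0 < lam)
    (hF : ∀ s, F s * s ≤ 0) {g : C(ℝ, Ell2)} {u : ℝ → Ell2} (hu : IsLatticeSolution ν lam F g u)
    {R η t₁ : ℝ} (ht₁ : 0 ≤ t₁) (hR : ∀ t ≥ t₁, ‖u t‖ ≤ R) {k : ℕ} (hk : 1 ≤ k)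
    (hη : ∀ t, ‖mulOp (ramp k) (abs_ramp_le_one k) (g t)‖ ≤ η) {t : ℝ} (ht : t₁ ≤ t) :
    ‖tail k (u t)‖ ^ 2 ≤
      R ^ 2 * Real.exp (-(2 * lam) * (t - t₁)) + (ν * R ^ 2 / k + R * η) / lam := by
  have hR0 : 0 ≤ R := (norm_nonneg _).trans (hR t₁ le_rfl)
  have hη0 : 0 ≤ η := (norm_nonneg _).trans (hη 0)
  set T := mulOp (ramp k) (abs_ramp_le_one k) with hT
  choose! w hw hd using hu
  have h := le_exp_of_deriv_le (E := fun t => inner ℝ (T (u t)) (u t))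
    (E' := fun t => inner ℝ (T (u t)) (w t) + inner ℝ (T (w t)) (u t)) (a := t₁) (b := t)
    (κ := 2 * lam) (c := 2 * (ν * R ^ 2 / k + R * η)) (by positivity) (by positivity)
    (fun s hs => by
      have h0 : HasDerivWithinAt u (w s) (Set.Icc t₁ t) s :=
        (hd s (ht₁.trans hs.1)).mono fun r hr => ht₁.trans hr.1
      exact (T.hasFDerivAt.comp_hasDerivWithinAt s h0).inner ℝ h0)
    (fun s hs => by
      have hus := hR s hs.1
      have e1 : inner ℝ (T (w s)) (u s) = inner ℝ (T (u s)) (w s) := by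
        rw [hT, inner_mulOp_comm, real_inner_comm]
      have e2 : inner ℝ (T (u s)) (g s) ≤ R * η := by
        rw [hT, inner_mulOp_comm]
        refine (real_inner_le_norm _ _).trans ?_
        gcongr
        exact hη s
      have e3 := tsum_weighted_laplacian_le (θ := ramp k) (δ := 1 / k) intSucc (ramp_nonneg k)
        (ramp_le_one k) (fun i => abs_ramp_sub_le (by
          change |(|i| - |i + 1|)| ≤ 1
          exact (abs_abs_sub_abs_le _ _).trans (by simp))) (summable_sq (u s))
      have s3 := summable_weighted_laplacian (θ := ramp k) intSucc (ramp_nonneg k)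
        (ramp_le_one k) (summable_sq (u s))
      rw [← norm_sq_eq] at e3
      have e4 : ν * (1 / k * ‖u s‖ ^ 2) ≤ ν * R ^ 2 / k := by
        have : ‖u s‖ ^ 2 ≤ R ^ 2 := by gcongr
        calc ν * (1 / k * ‖u s‖ ^ 2) ≤ ν * (1 / k * R ^ 2) := by gcongr
          _ = _ := by ring
      have e5 : inner ℝ (T (u s)) (w s) ≤ ν * R ^ 2 / k - lam * inner ℝ (T (u s)) (u s) +
          inner ℝ (T (u s)) (g s) := by
        rw [inner_eq (T (u s)) (w s)]
        have s4 := (summable_mul (T (u s)) (u s)).mul_left lam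
        have s5 := summable_mul (T (u s)) (g s)
        have s6 := ((s3.mul_left ν).sub s4).add s5
        refine (Summable.tsum_le_tsum (fun i => ?_) (summable_mul _ _) s6).trans ?_
        · rw [hT, mulOp_apply, hw s (ht₁.trans hs.1)]
          simp only [intSucc, Equiv.coe_fn_mk, Equiv.coe_fn_symm_mk]
          have := mul_nonpos_of_nonneg_of_nonpos (ramp_nonneg k i) (hF (u s i))
          linarith
        · rw [((s3.mul_left ν).sub s4).tsum_add s5, (s3.mul_left ν).tsum_sub s4, tsum_mul_left,
            tsum_mul_left, inner_eq, inner_eq]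
          have := mul_le_mul_of_nonneg_left e3 hν
          linarith
      linarith) t ⟨ht, le_rfl⟩
  refine (norm_tail_sq_le_inner hk (u t)).trans (h.trans ?_)
  have h1 : inner ℝ (T (u t₁)) (u t₁) ≤ R ^ 2 := by
    refine (real_inner_le_norm _ _).trans ?_
    rw [sq]
    exact mul_le_mul ((norm_mulOp_le _ _ _).trans (hR t₁ le_rfl)) (hR t₁ le_rfl)
      (norm_nonneg _) hR0
  have h2 : 2 * (ν * R ^ 2 / k + R * η) / (2 * lam) = (ν * R ^ 2 / k + R * η) / lam := by
    rw [mul_div_mul_left _ _ two_ne_zero]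
  rw [h2]
  gcongr

end Energy

/-! ### Compact dissipativity of the lattice cocycle for a Lagrange stable forcing -/

section Dissipative

theorem shift_mem_hull {E : Type*} [TopologicalSpace E] (f : C(ℝ, E)) (h : ℝ) :
    shift h f ∈ hull f := subset_closure ⟨h, rfl⟩

theorem norm_le_of_mem_hull {E : Type*} [NormedAddCommGroup E] {f : C(ℝ, E)} {C : ℝ}
    (hf : ∀ t, ‖f t‖ ≤ C) {g : C(ℝ, E)} (hg : g ∈ hull f) (t : ℝ) : ‖g t‖ ≤ C := by
  have hcl : IsClosed {g : C(ℝ, E) | ‖g t‖ ≤ C} :=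
    isClosed_le (continuous_eval_const t).norm continuous_const
  refine closure_minimal ?_ hcl hg
  rintro _ ⟨h, rfl⟩
  exact hf (t + h)

/-- Evaluation at `0` maps the compact hull onto one compact set, which by translation holds all
values of all its members; this yields tail bounds for the forcing uniform in time. -/
theorem apply_mem_of_mem_hull {E : Type*} [TopologicalSpace E] [T2Space E] {f : C(ℝ, E)}
    (hf : IsLagrangeStable f) {g : C(ℝ, E)} (hg : g ∈ hull f) (t : ℝ) :
    g t ∈ (fun g : C(ℝ, E) => g 0) '' hull f := by
  have hQ : IsClosed ((fun g : C(ℝ, E) => g 0) '' hull f) :=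
    (IsCompact.image hf (continuous_eval_const 0)).isClosed
  refine closure_minimal ?_ (hQ.preimage (continuous_eval_const t)) hg
  rintro _ ⟨h, rfl⟩
  refine ⟨shift (t + h) f, shift_mem_hull f _, ?_⟩
  simp [shift]

/-- The attracting set is cut out by the bound `R` and by countably many tail bounds, which make it
compact. Trajectories approach it because their truncations belong to it. -/
theorem isUniformlyCompactlyDissipative_of_tail {Y : Type*} {φ : ℝ → Ell2 → Y → Ell2} {Y₀ : Set Y}
    {R : ℝ} (hR0 : 0 ≤ R)
    (hR : ∀ ρ : ℝ, ∀ᶠ t in atTop, ∀ y ∈ Y₀, ∀ x : Ell2, ‖x‖ ≤ ρ → ‖φ t x y‖ ≤ R)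
    (htail : ∀ ε > 0, ∃ k : ℕ, ∀ ρ : ℝ, ∀ᶠ t in atTop, ∀ y ∈ Y₀, ∀ x : Ell2, ‖x‖ ≤ ρ →
      ‖tail k (φ t x y)‖ ≤ ε) :
    IsUniformlyCompactlyDissipative φ Y₀ := by
  obtain ⟨κ, hκ, hκt⟩ := extraction_forall_of_eventually (P := fun j k => ∀ ρ : ℝ, ∀ᶠ t in atTop,
    ∀ y ∈ Y₀, ∀ x : Ell2, ‖x‖ ≤ ρ → ‖tail k (φ t x y)‖ ≤ 1 / ((j : ℝ) + 1)) (fun j => by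
      obtain ⟨k, hk⟩ := htail (1 / ((j : ℝ) + 1)) (by positivity)
      filter_upwards [eventually_ge_atTop k] with l hl ρ
      filter_upwards [hk ρ] with t ht y hy x hx
      exact (norm_tail_anti hl _).trans (ht y hy x hx))
  set K : Set Ell2 := {x | ‖x‖ ≤ R ∧ ∀ j : ℕ, ‖tail (κ j) x‖ ≤ 1 / ((j : ℝ) + 1)} with hK
  have hKc : IsCompact K := by
    refine TotallyBounded.isCompact_of_isClosed
      (totallyBounded_of_norm_tail (fun x hx => hx.1) fun ε hε => ?_) ?_
    · obtain ⟨j, hj⟩ := exists_nat_one_div_lt hε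
      exact ⟨κ j, fun x hx => (hx.2 j).trans hj.le⟩
    · have hcl : IsClosed (⋂ j : ℕ, {x : Ell2 | ‖tail (κ j) x‖ ≤ 1 / ((j : ℝ) + 1)}) :=
        isClosed_iInter fun j => isClosed_le (by fun_prop) continuous_const
      convert (isClosed_le continuous_norm (continuous_const (y := R))).inter hcl using 1
      ext x
      simp [hK]
  refine ⟨K, ⟨0, by simpa using hR0, fun j => by simp; positivity⟩, hKc, fun M hM ε hε => ?_⟩
  obtain ⟨ρ, hρ⟩ := hM.isBounded.exists_norm_le
  obtain ⟨J, hJ⟩ := exists_nat_one_div_lt hε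
  have hev : ∀ᶠ t in atTop, ∀ j ∈ Finset.range (J + 1), ∀ y ∈ Y₀, ∀ x : Ell2, ‖x‖ ≤ ρ →
      ‖tail (κ j) (φ t x y)‖ ≤ 1 / ((j : ℝ) + 1) :=
    (Filter.eventually_all_finset _).mpr fun j _ => hκt j ρ
  obtain ⟨T, hT⟩ := eventually_atTop.mp (hev.and (hR ρ))
  refine ⟨max T 0, le_max_right _ _, fun t ht y hy x hx => ?_⟩
  obtain ⟨h1, h2⟩ := hT t ((le_max_left _ _).trans ht)
  set u := φ t x y
  -- For `j ≤ J` the truncation inherits the tail bound from `u`; for `j > J` its tail vanishes, as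
  -- `κ` is increasing.
  set z := embed (κ J) (restrict (κ J) u) with hz
  have hzu (i : ℤ) : |z i| ≤ |u i| := by
    rw [hz, embed_restrict_apply]
    split_ifs <;> simp
  have hmem : z ∈ K := by
    refine ⟨(norm_le_of_abs_le hzu).trans (h2 y hy x (hρ x hx)), fun j => ?_⟩
    rcases lt_or_ge j (J + 1) with hj | hj
    · exact (norm_tail_le_of_abs_le hzu).trans
        (h1 j (Finset.mem_range.mpr hj) y hy x (hρ x hx))
    · have h0 : tail (κ j) z = 0 := by
        ext i
        have hle : κ J ≤ κ j := hκ.monotone (by omega)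
        rw [tail_apply, hz, embed_restrict_apply]
        split_ifs
        · omega
        · rfl
        · rfl
      rw [h0, norm_zero]
      positivity
  calc Metric.infDist u K ≤ dist u z := Metric.infDist_le_dist_of_mem hmem
    _ = ‖tail (κ J) u‖ := by rw [dist_eq_norm, hz, embed_restrict, sub_sub_cancel]
    _ ≤ 1 / ((J : ℝ) + 1) := h1 J (by simp) y hy x (hρ x hx)
    _ < ε := hJ

variable {ν lam : ℝ} {F : ℝ → ℝ}

theorem isUniformlyCompactlyDissipative_of_isLagrangeStable (hν : 0 ≤ ν) (hlam : 0 < lam)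
    (hFL : IsLocLip F) (hF0 : F 0 = 0) (hF : ∀ s, F s * s ≤ 0) {f : C(ℝ, Ell2)} {C : ℝ}
    (hf : ∀ t, ‖f t‖ ≤ C) (hL : IsLagrangeStable f) :
    IsUniformlyCompactlyDissipative (latticeCocycle ν lam F) (hull f) := by
  have hC : 0 ≤ C := (norm_nonneg _).trans (hf 0)
  set R := C / lam + 1 with hR
  have hR0 : 0 < R := by positivity
  have habs (ρ : ℝ) : ∃ T : ℝ, 0 ≤ T ∧ ∀ t ≥ T, ∀ g ∈ hull f, ∀ x : Ell2, ‖x‖ ≤ ρ →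
      ‖latticeCocycle ν lam F t x g‖ ≤ R := by
    obtain ⟨T, hT0, hT⟩ := exists_absorbing_time hlam hC ρ
    refine ⟨T, hT0, fun t ht g hg x hx => ?_⟩
    obtain ⟨hu, hu0⟩ := latticeCocycle_spec hν hlam hFL hF0 hF (norm_le_of_mem_hull hf hg) x
    have h := lattice_norm_sq_le hν hlam hFL hF0 hF (norm_le_of_mem_hull hf hg) hu (hT0.trans ht)
    rw [hu0] at h
    exact hT t ht _ _ (norm_nonneg _) hx (norm_nonneg _) h
  refine isUniformlyCompactlyDissipative_of_tail hR0.le (fun ρ => ?_) fun ε hε => ?_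
  · obtain ⟨T, -, hT⟩ := habs ρ
    exact eventually_atTop.mpr ⟨T, hT⟩
  -- The budget is `ε ^ 2`: the term `R * η / lam` takes a quarter, the terms with `1 / k` another
  -- quarter, and the decaying exponential a half.
  · set η := ε ^ 2 * lam / (4 * R) with hη
    have hη0 : 0 < η := by positivity
    obtain ⟨m, hm⟩ := exists_norm_tail_le_of_isCompact
      (IsCompact.image hL (continuous_eval_const (0 : ℝ))) hη0
    obtain ⟨k, -, hk1, hk⟩ := exists_div_le ((ν * R ^ 2 + R * (m * C)) / lam)
      (ε := ε ^ 2 / 4) (by positivity) 0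
    refine ⟨k, fun ρ => ?_⟩
    obtain ⟨T₁, hT₁0, hT₁⟩ := habs ρ
    obtain ⟨T, hTT, hT0, hT⟩ := exists_exp_le (A := R ^ 2) (κ := 2 * lam) (ε := ε ^ 2 / 2)
      (by positivity) (by positivity) T₁
    refine eventually_atTop.mpr ⟨T, fun t ht g hg x hx => ?_⟩
    obtain ⟨hu, hu0⟩ := latticeCocycle_spec hν hlam hFL hF0 hF (norm_le_of_mem_hull hf hg) x
    have h := lattice_tail_sq_le hν hlam hF hu hT₁0 (fun t ht => hT₁ t ht g hg x hx) hk1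
      (η := η + m / k * C) (fun t => (norm_ramp_mul_le k m _).trans (by
        gcongr
        · exact hm _ (apply_mem_of_mem_hull hL hg t)
        · exact norm_le_of_mem_hull hf hg t)) (hTT.trans ht)
    refine le_of_sq_le_sq ?_ hε.le
    have e1 : (ν * R ^ 2 / k + R * (η + m / k * C)) / lam =
        (ν * R ^ 2 + R * (m * C)) / lam / k + ε ^ 2 / 4 := by
      rw [hη]
      have : (0 : ℝ) < k := by exact_mod_cast hk1
      field_simp
      ring
    rw [e1] at h
    linarith [hT t ht]

end Dissipative

/-! ### Comparison of the finite systems with the lattice system -/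

section Comparison

variable {ν lam : ℝ} {F : ℝ → ℝ}

theorem sum_abs_mul_le {n : ℕ} (v w : FinSpace n) : ∑ i, |v i| * |w i| ≤ ‖v‖ * ‖w‖ := by
  have h := real_inner_le_norm (WithLp.toLp 2 fun i => |v i| : FinSpace n)
    (WithLp.toLp 2 fun i => |w i|)
  have e (z : FinSpace n) : ‖(WithLp.toLp 2 fun i => |z i| : FinSpace n)‖ = ‖z‖ := by
    rw [← sq_eq_sq₀ (norm_nonneg _) (norm_nonneg _), norm_sq_finSpace, norm_sq_finSpace]
    simp
  rwa [e, e, inner_eq_finSpace] at h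

theorem abs_apply_le_finSpace {n : ℕ} (v : FinSpace n) (i : Idx n) : |v i| ≤ ‖v‖ := by
  simpa using PiLp.norm_apply_le v i

/-- The defect of the periodic boundary conditions. -/
theorem sum_boundary_le {n m : ℕ} (hmn : m < n) (x : Ell2) :
    ∑ i : Idx n, |x (cyclicPred i) - x (i - 1) + (x (cyclicSucc i) - x (i + 1))| ≤
      4 * ‖tail m x‖ := by
  have hx {i : ℤ} (hi : (n : ℤ) ≤ |i|) : |x i| ≤ ‖tail m x‖ :=
    abs_apply_le_norm_tail (by omega) x
  have h2 {i j : ℤ} (hi : (n : ℤ) ≤ |i|) (hj : (n : ℤ) ≤ |j|) : |x i - x j| ≤ 2 * ‖tail m x‖ :=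
    (abs_sub _ _).trans (by linarith [hx hi, hx hj])
  -- The cyclic predecessor differs from `i - 1` only at `i = -n`, where both indices have absolute
  -- value at least `n > m`.
  have p1 : ∑ i : Idx n, |x (cyclicPred i) - x (i - 1)| ≤ 2 * ‖tail m x‖ := by
    rw [Finset.sum_eq_single (⟨-(n : ℤ), by simp⟩ : Idx n)]
    · rw [cyclicPred_coe, if_pos rfl]
      exact h2 (by simp) (by dsimp only; exact le_abs.mpr (by omega))
    · intro i _ hi
      rw [cyclicPred_coe, if_neg (fun h => hi (Subtype.ext h)), sub_self, abs_zero]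
    · simp
  have p2 : ∑ i : Idx n, |x (cyclicSucc i) - x (i + 1)| ≤ 2 * ‖tail m x‖ := by
    rw [Finset.sum_eq_single (⟨(n : ℤ), by simp⟩ : Idx n)]
    · rw [cyclicSucc_coe, if_pos rfl]
      exact h2 (by simp) (by dsimp only; exact le_abs.mpr (by omega))
    · intro i _ hi
      rw [cyclicSucc_coe, if_neg (fun h => hi (Subtype.ext h)), sub_self, abs_zero]
    · simp
  calc _ ≤ ∑ i : Idx n, (|x (cyclicPred i) - x (i - 1)| + |x (cyclicSucc i) - x (i + 1)|) :=
        Finset.sum_le_sum fun i _ => abs_add_le _ _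
    _ ≤ _ := by rw [Finset.sum_add_distrib]; linarith

/-- The weighted energy inequality for the difference of a solution of the finite system and the
restriction of a solution of the lattice system with the same forcing. -/
theorem exists_deriv_energy_le (hν : 0 ≤ ν) {g : C(ℝ, Ell2)} {w : ℝ → Ell2}
    (hw : IsLatticeSolution ν lam F g w) {n m : ℕ} (hmn : m < n) {p : ℝ → FinSpace n}
    (hp : IsFinSolution ν lam F (truncate n g) p) {θ : ℤ → ℝ} {δ : ℝ} (h0 : ∀ i, 0 ≤ θ i)
    (h1 : ∀ i, θ i ≤ 1) (hδ : ∀ i : Idx n, |θ i - θ (cyclicSucc i)| ≤ δ) {t : ℝ} (ht : 0 ≤ t) :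
    ∃ E' : ℝ, HasDerivWithinAt (fun t => ∑ i : Idx n, θ i * (p t - restrict n (w t)) i ^ 2) E'
        (Set.Ici 0) t ∧
      E' ≤ 2 * (ν * δ * ‖p t - restrict n (w t)‖ ^ 2 -
        lam * ∑ i : Idx n, θ i * (p t - restrict n (w t)) i ^ 2 +
        ∑ i : Idx n, θ i * (p t - restrict n (w t)) i * (F (p t i) - F (w t i)) +
        4 * ν * ‖p t - restrict n (w t)‖ * ‖tail m (w t)‖) := by
  obtain ⟨w', hw', hd⟩ := hw t ht
  set z := p t - restrict n (w t) with hz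
  have hzi (i : Idx n) : z i = p t i - w t i := rfl
  have hdi (i : Idx n) : HasDerivWithinAt (fun t => (p t - restrict n (w t)) i)
      (finField ν lam F (truncate n g t) (p t) i - w' i) (Set.Ici 0) t := by
    have a1 := ((EuclideanSpace.proj (𝕜 := ℝ) i : FinSpace n →L[ℝ] ℝ).hasFDerivAt
      (x := p t)).comp_hasDerivWithinAt t (hp t ht)
    have a2 := ((lp.evalCLM ℝ (fun _ : ℤ => ℝ) 2 (i : ℤ)).hasFDerivAt
      (x := w t)).comp_hasDerivWithinAt t hd
    exact a1.sub a2
  refine ⟨_, HasDerivWithinAt.fun_sum fun i _ => ((hdi i).pow 2).const_mul (θ i), ?_⟩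
  -- The restriction of `w` satisfies the periodic system up to this defect, supported at the two
  -- endpoints.
  set b : Idx n → ℝ := fun i =>
    w t (cyclicPred i) - w t (i - 1) + (w t (cyclicSucc i) - w t (i + 1)) with hb
  have e1 := tsum_weighted_laplacian_le (θ := fun i : Idx n => θ i) (x := fun i => z i) (δ := δ)
    (cyclicPerm n) (fun i => h0 i) (fun i => h1 i) hδ Summable.of_finite
  rw [tsum_fintype, tsum_fintype, ← norm_sq_finSpace] at e1
  have e2 : ∑ i : Idx n, θ i * z i * b i ≤ ‖z‖ * (4 * ‖tail m (w t)‖) := by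
    refine le_trans ?_ (mul_le_mul_of_nonneg_left (sum_boundary_le hmn (w t)) (norm_nonneg z))
    rw [Finset.mul_sum]
    refine Finset.sum_le_sum fun i _ => (le_abs_self _).trans ?_
    rw [abs_mul, abs_mul, abs_of_nonneg (h0 i)]
    refine mul_le_mul_of_nonneg_right ?_ (abs_nonneg _)
    exact (mul_le_of_le_one_left (abs_nonneg _) (h1 i)).trans (abs_apply_le_finSpace z i)
  have e3 := mul_le_mul_of_nonneg_left e1 hν
  have e4 := mul_le_mul_of_nonneg_left e2 hν
  refine le_trans (le_of_eq ?_) (b := 2 * (ν * ∑ i : Idx n,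
    θ i * z i * (z ((cyclicPerm n).symm i) - 2 * z i + z (cyclicPerm n i)) -
    lam * ∑ i : Idx n, θ i * z i ^ 2 + ∑ i : Idx n, θ i * z i * (F (p t i) - F (w t i)) +
    ν * ∑ i : Idx n, θ i * z i * b i)) (by linarith)
  rw [Finset.mul_sum, Finset.mul_sum, Finset.mul_sum, ← Finset.sum_sub_distrib,
    ← Finset.sum_add_distrib, ← Finset.sum_add_distrib, Finset.mul_sum]
  refine Finset.sum_congr rfl fun i _ => ?_
  have hg : truncate n g t i = g t i := rfl
  simp only [hw', hb, finField, cyclicPerm, Equiv.coe_fn_mk, Equiv.coe_fn_symm_mk, hzi, hg,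
    PiLp.sub_apply, restrict_apply, Nat.add_one_sub_one, pow_one, Nat.cast_ofNat]
  ring

end Comparison

/-! ### Uniform tails of the finite systems and their convergence on bounded time intervals -/

section Limit

variable {ν lam : ℝ} {F : ℝ → ℝ}

theorem abs_cyclicSucc_sub_le {n : ℕ} (i : Idx n) :
    |(|(i : ℤ)| - |(cyclicSucc i : ℤ)|)| ≤ 1 := by
  rw [cyclicSucc_coe]
  split_ifs with h
  · rw [h, abs_neg, sub_self, abs_zero]
    exact zero_le_one
  · exact (abs_abs_sub_abs_le _ _).trans (by simp)

/-- Subtracting `w`, driven by the same forcing, removes the forcing from the energy balance, so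
only the tails of `w` enter. The tail of `p` is then that of the difference plus that of `w`. -/
theorem fin_tail_le (hν : 0 ≤ ν) (hlam : 0 < lam) (hF : ∀ s, F s * s ≤ 0) {R L η t₁ : ℝ}
    (hL : 0 ≤ L) (hFL : ∀ s, |s| ≤ R → |F s| ≤ L * |s|) {g : C(ℝ, Ell2)} {w : ℝ → Ell2}
    (hw : IsLatticeSolution ν lam F g w) {n m k : ℕ} (hmn : m < n) (hmk : m ≤ k) (hk : 1 ≤ k)
    {p : ℝ → FinSpace n} (hp : IsFinSolution ν lam F (truncate n g) p) (ht₁ : 0 ≤ t₁)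
    (hpR : ∀ t ≥ t₁, ‖p t‖ ≤ R) (hwR : ∀ t ≥ t₁, ‖w t‖ ≤ R) (hη : ∀ t ≥ t₁, ‖tail m (w t)‖ ≤ η)
    {t : ℝ} (ht : t₁ ≤ t) :
    ‖tail k (embed n (p t))‖ ≤
      Real.sqrt (4 * R ^ 2 * Real.exp (-(2 * lam) * (t - t₁)) +
        (4 * ν * R ^ 2 / k + 3 * L * R * (η + m / k * R) + 8 * ν * R * η) / lam) + η := by
  have hR0 : 0 ≤ R := (norm_nonneg _).trans (hpR t₁ le_rfl)
  have hη0 : 0 ≤ η := (norm_nonneg _).trans (hη t₁ le_rfl)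
  have hz2 : ∀ s ≥ t₁, ‖p s - restrict n (w s)‖ ≤ 2 * R := fun s hs =>
    (norm_sub_le _ _).trans (by linarith [hpR s hs, hwR s hs, norm_restrict_le n (w s)])
  have hE := fun s (hs : 0 ≤ s) => exists_deriv_energy_le hν hw hmn hp (ramp_nonneg k)
    (ramp_le_one k) (fun i => abs_ramp_sub_le (abs_cyclicSucc_sub_le i)) hs
  choose! E' hd hE' using hE
  have h := le_exp_of_deriv_le (κ := 2 * lam)
    (c := 2 * (4 * ν * R ^ 2 / k + 3 * L * R * (η + m / k * R) + 8 * ν * R * η)) (by positivity)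
    (by positivity)
    (fun s (hs : s ∈ Set.Icc t₁ t) => (hd s (ht₁.trans hs.1)).mono fun r hr => ht₁.trans hr.1)
    (fun s hs => by
      have h1 := hE' s (ht₁.trans hs.1)
      have hz := hz2 s hs.1
      set z := p s - restrict n (w s) with hzdef
      have hzi (i : Idx n) : z i = p s i - w s i := rfl
      have a1 : ν * (1 / k) * ‖z‖ ^ 2 ≤ 4 * ν * R ^ 2 / k := by
        calc ν * (1 / k) * ‖z‖ ^ 2 ≤ ν * (1 / k) * (2 * R) ^ 2 := by gcongr
          _ = _ := by ring
      have a2 : 4 * ν * ‖z‖ * ‖tail m (w s)‖ ≤ 8 * ν * R * η := by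
        calc 4 * ν * ‖z‖ * ‖tail m (w s)‖ ≤ 4 * ν * (2 * R) * η := by
              gcongr
              exact hη s hs.1
          _ = _ := by ring
      set y := restrict n (mulOp (ramp k) (abs_ramp_le_one k) (w s)) with hy
      have hyn : ‖y‖ ≤ η + m / k * R := by
        refine (norm_restrict_le _ _).trans ((norm_ramp_mul_le k m _).trans ?_)
        gcongr
        exacts [hη s hs.1, hwR s hs.1]
      have a3 : ∑ i : Idx n, ramp k i * z i * (F (p s i) - F (w s i)) ≤
          3 * L * R * (η + m / k * R) := by
        calc _ ≤ ∑ i : Idx n, L * (|y i| * |p s i| + |y i| * |z i|) := by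
              refine Finset.sum_le_sum fun i _ => ?_
              have c0 := ramp_nonneg k i
              have c1 := hFL (p s i) ((abs_apply_le_finSpace _ i).trans (hpR s hs.1))
              have c2 := hFL (w s i) ((abs_apply_le _ i).trans (hwR s hs.1))
              have c3 : |y i| = ramp k i * |w s i| := by
                rw [hy, restrict_apply, mulOp_apply, abs_mul, abs_of_nonneg c0]
              -- Expanding with `z = p - w`, the only product free of `w` is `F(p) p ≤ 0`; the
              -- others are bounded through `|F(s)| ≤ L |s|` and keep a factor `|w|`, which absorbs
              -- the ramp weight into `y`.
              have c4 : z i * (F (p s i) - F (w s i)) ≤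
                  L * (|w s i| * |p s i| + |w s i| * |z i|) := by
                have d1 : -(w s i * F (p s i)) ≤ |w s i| * (L * |p s i|) := by
                  refine (neg_le_abs _).trans ?_
                  rw [abs_mul]
                  gcongr
                have d2 : -(z i * F (w s i)) ≤ |z i| * (L * |w s i|) := by
                  refine (neg_le_abs _).trans ?_
                  rw [abs_mul]
                  gcongr
                have d3 := hF (p s i)
                have d4 : z i * (F (p s i) - F (w s i)) =
                    F (p s i) * p s i - w s i * F (p s i) - z i * F (w s i) := by
                  rw [hzi]; ring
                linarith
              rw [c3, mul_assoc]
              refine (mul_le_mul_of_nonneg_left c4 c0).trans (le_of_eq ?_)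
              ring
          _ = L * (∑ i, |y i| * |p s i| + ∑ i, |y i| * |z i|) := by
              rw [← Finset.mul_sum, Finset.sum_add_distrib]
          _ ≤ L * ((η + m / k * R) * R + (η + m / k * R) * (2 * R)) := by
              gcongr
              · exact (sum_abs_mul_le y (p s)).trans
                  (mul_le_mul hyn (hpR s hs.1) (norm_nonneg _) (by positivity))
              · exact (sum_abs_mul_le y z).trans
                  (mul_le_mul hyn hz (norm_nonneg _) (by positivity))
          _ = _ := by ring
      linarith) t ⟨ht, le_rfl⟩
  have hstart : ∑ i : Idx n, ramp k i * (p t₁ - restrict n (w t₁)) i ^ 2 ≤ 4 * R ^ 2 := by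
    calc _ ≤ ∑ i : Idx n, (p t₁ - restrict n (w t₁)) i ^ 2 :=
          Finset.sum_le_sum fun i _ => mul_le_of_le_one_left (sq_nonneg _) (ramp_le_one k i)
      _ = ‖p t₁ - restrict n (w t₁)‖ ^ 2 := (norm_sq_finSpace _).symm
      _ ≤ (2 * R) ^ 2 := by
          gcongr
          exact hz2 t₁ le_rfl
      _ = _ := by ring
  have hend : ‖tail k (embed n (p t - restrict n (w t)))‖ ^ 2 ≤
      ∑ i : Idx n, ramp k i * (p t - restrict n (w t)) i ^ 2 := by
    refine (norm_tail_sq_le_inner hk _).trans (le_of_eq ?_)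
    rw [inner_eq]
    simp only [mulOp_apply]
    rw [tsum_embed _ (fun i s => ramp k i * s * s) (by simp)]
    exact Finset.sum_congr rfl fun i _ => by ring
  have hsplit : tail k (embed n (p t)) =
      tail k (embed n (p t - restrict n (w t))) + tail k (embed n (restrict n (w t))) := by
    rw [← map_add, embed_sub, sub_add_cancel]
  rw [hsplit]
  refine (norm_add_le _ _).trans (add_le_add (Real.le_sqrt_of_sq_le ?_) ?_)
  · refine hend.trans (h.trans ?_)
    rw [mul_div_mul_left _ _ two_ne_zero]
    gcongr
  · refine (norm_tail_le_of_abs_le (y := w t) fun i => ?_).trans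
      ((norm_tail_anti hmk _).trans (hη t ht))
    rw [embed_restrict_apply]
    split_ifs <;> simp

theorem exists_fin_tail_le (hν : 0 ≤ ν) (hlam : 0 < lam) (hFL : IsLocLip F) (hF0 : F 0 = 0)
    (hF : ∀ s, F s * s ≤ 0) {R : ℝ} (hR : 0 ≤ R) {g : ℕ → C(ℝ, Ell2)} {w : ℕ → ℝ → Ell2}
    {p : (n : ℕ) → ℝ → FinSpace n} (hw : ∀ n, IsLatticeSolution ν lam F (g n) (w n))
    (hp : ∀ n, IsFinSolution ν lam F (truncate n (g n)) (p n))
    (hwR : ∀ n, ∀ t ≥ (0 : ℝ), ‖w n t‖ ≤ R) (hpR : ∀ n, ∀ t ≥ (0 : ℝ), ‖p n t‖ ≤ R)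
    (htail : ∀ η > 0, ∃ m : ℕ, ∃ T ≥ (0 : ℝ), ∀ n, ∀ t ≥ T, ‖tail m (w n t)‖ ≤ η)
    {ε : ℝ} (hε : 0 < ε) :
    ∃ k : ℕ, ∃ T : ℝ, ∃ N : ℕ, ∀ n ≥ N, ∀ t ≥ T, ‖tail k (embed n (p n t))‖ ≤ ε := by
  obtain ⟨L, hL, -, hLF⟩ := hFL.abs_le hF0 R
  -- `B` collects the coefficients of `η`. First `η` fixes `m` and `T₁`, then `k` beats the terms
  -- with `m / k`, and last `T` beats the exponential.
  set B := 3 * L * R + 8 * ν * R with hB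
  have hB0 : 0 ≤ B := by positivity
  obtain ⟨m, T₁, hT₁0, hm⟩ := htail (min (ε / 2) (ε ^ 2 * lam / (16 * (B + 1)))) (by positivity)
  set η := min (ε / 2) (ε ^ 2 * lam / (16 * (B + 1))) with hη
  obtain ⟨k, hmk, hk1, hk⟩ := exists_div_le ((4 * ν * R ^ 2 + 3 * L * R * (m * R)) / lam)
    (ε := ε ^ 2 / 16) (by positivity) m
  obtain ⟨T, hTT, -, hT⟩ := exists_exp_le (A := 4 * R ^ 2) (κ := 2 * lam) (ε := ε ^ 2 / 16)
    (by positivity) (by positivity) T₁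
  refine ⟨k, T, m + 1, fun n hn t ht => ?_⟩
  have h := fin_tail_le hν hlam hF hL hLF (hw n) hn hmk hk1 (hp n) hT₁0
    (fun t ht => hpR n t (hT₁0.trans ht)) (fun t ht => hwR n t (hT₁0.trans ht)) (hm n)
    (hTT.trans ht)
  have h1 : η ≤ ε / 2 := min_le_left _ _
  have h2 : B * η / lam ≤ ε ^ 2 / 16 := by
    have hη2 : η ≤ ε ^ 2 * lam / (16 * (B + 1)) := min_le_right _ _
    rw [le_div_iff₀ (by positivity)] at hη2
    rw [div_le_iff₀ hlam]
    have hη0 : 0 ≤ η := by positivity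
    nlinarith
  have h3 : (4 * ν * R ^ 2 / k + 3 * L * R * (η + m / k * R) + 8 * ν * R * η) / lam =
      (4 * ν * R ^ 2 + 3 * L * R * (m * R)) / lam / k + B * η / lam := by
    have : (0 : ℝ) < k := by exact_mod_cast hk1
    rw [hB]
    field_simp
    ring
  have h4 : Real.sqrt (4 * R ^ 2 * Real.exp (-(2 * lam) * (t - T₁)) +
      (4 * ν * R ^ 2 / k + 3 * L * R * (η + m / k * R) + 8 * ν * R * η) / lam) ≤ ε / 2 := by
    refine Real.sqrt_le_iff.mpr ⟨by positivity, ?_⟩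
    rw [h3]
    have := hT t ht
    nlinarith [sq_nonneg ε]
  linarith

/-- The orbit of `u` over `[0, b]` is compact, so its tails are uniformly small and the boundary
defect is negligible for large `n`. Gronwall with weight `1` then controls the difference. -/
theorem fin_approximates_lattice (hν : 0 ≤ ν) (hlam : 0 < lam) (hFL : IsLocLip F)
    {g : C(ℝ, Ell2)} {u : ℝ → Ell2} (hu : IsLatticeSolution ν lam F g u) {b : ℝ} (hb : 0 ≤ b)
    (R : ℝ) {ε : ℝ} (hε : 0 < ε) :
    ∃ d > 0, ∃ N : ℕ, ∀ n ≥ N, ∀ p : ℝ → FinSpace n, IsFinSolution ν lam F (truncate n g) p →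
      (∀ t ≥ (0 : ℝ), ‖p t‖ ≤ R) → ‖embed n (p 0) - u 0‖ ≤ d → ‖embed n (p b) - u b‖ ≤ ε := by
  have hcont : ContinuousOn u (Set.Icc 0 b) := fun t ht => by
    obtain ⟨w, -, hd⟩ := hu t ht.1
    exact hd.continuousWithinAt.mono Set.Icc_subset_Ici_self
  have hcomp : IsCompact (u '' Set.Icc 0 b) := isCompact_Icc.image_of_continuousOn hcont
  obtain ⟨R₁, hR₁⟩ := hcomp.isBounded.exists_norm_le
  set R₂ := max R (max R₁ 0) with hR₂
  have hR₂0 : 0 ≤ R₂ := (le_max_right _ _).trans (le_max_right _ _)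
  obtain ⟨L, hL, hLF⟩ := hFL R₂
  -- The rate `2 * L + 1` in place of `2 * L` is at least `1`, so the division by it in the Gronwall
  -- bound is harmless.
  set Q := Real.exp ((2 * L + 1) * (b - 0)) with hQ
  have hQ0 : 0 < Q := Real.exp_pos _
  set B := 16 * ν * R₂ with hB
  have hB0 : 0 ≤ B := by positivity
  set η := min (ε / 2) (ε ^ 2 / (8 * Q * (B + 1))) with hη
  have hη0 : 0 < η := by positivity
  obtain ⟨m, hm⟩ := exists_norm_tail_le_of_isCompact hcomp hη0
  -- The bound by `1` gives `d ^ 2 ≤ d`, so the squared initial error is at most `ε ^ 2 / (8 * Q)`.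
  refine ⟨min 1 (ε ^ 2 / (8 * Q)), by positivity, m + 1, fun n hn p hp hpR hp0 => ?_⟩
  set d := min 1 (ε ^ 2 / (8 * Q)) with hd
  have hE := fun s (hs : 0 ≤ s) => exists_deriv_energy_le (θ := fun _ => 1) (δ := 0) hν hu hn hp
    (fun _ => zero_le_one) (fun _ => le_rfl) (fun i => by simp) hs
  choose! E' hd' hE' using hE
  have h := le_gronwallBound_of_deriv_le (κ := 2 * L + 1) (c := B * η)
    (fun s (hs : s ∈ Set.Icc 0 b) => (hd' s hs.1).mono Set.Icc_subset_Ici_self)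
    (fun s hs => by
      have h1 := hE' s hs.1
      have hus : ‖u s‖ ≤ R₂ := (hR₁ _ (Set.mem_image_of_mem u hs)).trans
        ((le_max_left _ _).trans (le_max_right _ _))
      have hps : ‖p s‖ ≤ R₂ := (hpR s hs.1).trans (le_max_left _ _)
      have hz : ‖p s - restrict n (u s)‖ ≤ 2 * R₂ :=
        (norm_sub_le _ _).trans (by linarith [norm_restrict_le n (u s)])
      set z := p s - restrict n (u s) with hzdef
      have hzi (i : Idx n) : z i = p s i - u s i := rfl
      have a1 : 4 * ν * ‖z‖ * ‖tail m (u s)‖ ≤ B * η / 2 := by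
        calc 4 * ν * ‖z‖ * ‖tail m (u s)‖ ≤ 4 * ν * (2 * R₂) * η := by
              gcongr
              exact hm _ (Set.mem_image_of_mem u hs)
          _ = _ := by rw [hB]; ring
      have a2 : ∑ i : Idx n, 1 * z i * (F (p s i) - F (u s i)) ≤ L * ∑ i, 1 * z i ^ 2 := by
        rw [Finset.mul_sum]
        refine Finset.sum_le_sum fun i _ => (le_abs_self _).trans ?_
        have c1 := hLF (p s i) (u s i) ((abs_apply_le_finSpace _ i).trans hps)
          ((abs_apply_le _ i).trans hus)
        rw [one_mul, one_mul, abs_mul, ← sq_abs (z i), hzi]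
        calc _ ≤ |p s i - u s i| * (L * |p s i - u s i|) := by gcongr
          _ = _ := by ring
      have a3 : 0 ≤ ∑ i : Idx n, 1 * z i ^ 2 :=
        Finset.sum_nonneg fun i _ => by positivity
      have a4 := mul_nonneg hlam.le a3
      linarith) b ⟨hb, le_rfl⟩
  simp only [one_mul, ← norm_sq_finSpace] at h
  have hz0 : ‖p 0 - restrict n (u 0)‖ ≤ d := by
    refine le_trans ?_ hp0
    rw [← norm_embed, embed_sub]
    refine norm_le_of_abs_le fun i => ?_
    rw [lp.coeFn_sub, lp.coeFn_sub, Pi.sub_apply, Pi.sub_apply, embed_restrict_apply]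
    split_ifs with hi
    · exact le_rfl
    · rw [embed_apply, dif_neg (fun h' => hi (mem_Icc_iff_abs.mp h')), sub_zero, abs_zero]
      exact abs_nonneg _
  have hzb : ‖p b - restrict n (u b)‖ ≤ ε / 2 := by
    refine le_of_sq_le_sq (h.trans ?_) (by positivity)
    rw [gronwallBound_of_K_ne_0 (by positivity)]
    change _ * Q + B * η / (2 * L + 1) * (Q - 1) ≤ _
    have d1 : ‖p 0 - restrict n (u 0)‖ ^ 2 * Q ≤ ε ^ 2 / 8 := by
      have d2 : d ≤ 1 := min_le_left _ _
      have d3 : d ≤ ε ^ 2 / (8 * Q) := min_le_right _ _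
      have d4 : ‖p 0 - restrict n (u 0)‖ ^ 2 ≤ ε ^ 2 / (8 * Q) := by
        nlinarith [norm_nonneg (p 0 - restrict n (u 0))]
      calc _ ≤ ε ^ 2 / (8 * Q) * Q := by gcongr
        _ = _ := by field_simp
    have d5 : B * η / (2 * L + 1) * (Q - 1) ≤ ε ^ 2 / 8 := by
      have d6 : η ≤ ε ^ 2 / (8 * Q * (B + 1)) := min_le_right _ _
      calc B * η / (2 * L + 1) * (Q - 1) ≤ B * η / 1 * Q := by
            have : 1 ≤ Q := Real.one_le_exp (by rw [sub_zero]; positivity)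
            gcongr <;> linarith
        _ ≤ (B + 1) * (ε ^ 2 / (8 * Q * (B + 1))) / 1 * Q := by
            gcongr
            linarith
        _ = _ := by field_simp
    nlinarith [sq_nonneg ε]
  have hsplit : embed n (p b) - u b = embed n (p b - restrict n (u b)) - tail n (u b) := by
    rw [embed_sub, embed_restrict]
    abel
  rw [hsplit]
  refine (norm_sub_le _ _).trans ?_
  rw [norm_embed]
  have e1 : ‖tail n (u b)‖ ≤ η := (norm_tail_anti (by omega) _).trans
    (hm _ (Set.mem_image_of_mem u ⟨hb, le_rfl⟩))
  have e2 : η ≤ ε / 2 := min_le_left _ _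
  linarith

theorem IsFinSolution.shift {n : ℕ} {g : C(ℝ, FinSpace n)} {p : ℝ → FinSpace n}
    (hp : IsFinSolution ν lam F g p) {a : ℝ} (ha : 0 ≤ a) :
    IsFinSolution ν lam F (shift a g) fun t => p (t + a) := fun t ht => by
  have h1 : HasDerivWithinAt (fun t : ℝ => t + a) 1 (Set.Ici 0) t :=
    ((hasDerivAt_id t).add_const a).hasDerivWithinAt
  have h := HasDerivWithinAt.scomp t (hp (t + a) (add_nonneg ht ha)) h1
    (fun s (hs : 0 ≤ s) => add_nonneg hs ha)
  rw [one_smul] at h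
  exact h

theorem shift_truncate_shift {n : ℕ} (f : C(ℝ, Ell2)) (a b : ℝ) :
    LatticeSystem.shift a (truncate n (LatticeSystem.shift b f)) =
      truncate n (LatticeSystem.shift (a + b) f) := by
  ext t i
  simp [LatticeSystem.shift, truncate, add_assoc]

end Limit

/-! ### Backward trajectories and passage to the limit -/

section Main

variable {ν lam : ℝ} {F : ℝ → ℝ}

theorem norm_truncate_shift_le {f : C(ℝ, Ell2)} {C : ℝ} (hf : ∀ t, ‖f t‖ ≤ C) (n : ℕ) (h t : ℝ) :
    ‖truncate n (shift h f) t‖ ≤ C :=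
  (norm_restrict_le n (f (t + h))).trans (hf _)

/-- A point of the attractor of the finite system is nearly reached at time `n` by a solution which
stays in the absorbing ball. -/
theorem exists_fin_solution_near (hν : 0 ≤ ν) (hlam : 0 < lam) (hFL : IsLocLip F) (hF0 : F 0 = 0)
    (hF : ∀ s, F s * s ≤ 0) {f : C(ℝ, Ell2)} {C : ℝ} (hf : ∀ t, ‖f t‖ ≤ C) {n : ℕ} {v : FinSpace n}
    (hv : v ∈ levinsonCenter (finCocycle ν lam F n) shift (hull (truncate n f)) (truncate n f)) :
    ∃ p : ℝ → FinSpace n, IsFinSolution ν lam F (truncate n (shift (-n) f)) p ∧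
      (∀ t ≥ (0 : ℝ), ‖p t‖ ≤ C / lam + 1) ∧ dist (p n) v < 1 / ((n : ℝ) + 1) := by
  have hC : 0 ≤ C := (norm_nonneg _).trans (hf 0)
  obtain ⟨K, ⟨-, hKc, -⟩, hvK⟩ := hv
  obtain ⟨ρ, hρ⟩ := hKc.isBounded.exists_norm_le
  obtain ⟨T, hT0, hT⟩ := exists_absorbing_time hlam hC ρ
  -- Time `T` serves to enter the absorbing ball, and the last `n` units of time form the trajectory
  -- that is kept.
  have hcl := Set.mem_iInter₂.mp hvK (T + n) (add_nonneg hT0 n.cast_nonneg)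
  obtain ⟨q, hq, hqv⟩ := Metric.mem_closure_iff.mp hcl (1 / ((n : ℝ) + 1)) (by positivity)
  obtain ⟨τ, hτ, x, hx, rfl⟩ := Set.mem_iUnion₂.mp hq
  have hτ' : T + n ≤ τ := hτ
  have hg (t : ℝ) : ‖shift (-τ) (truncate n f) t‖ ≤ C :=
    (norm_restrict_le n (f (t + -τ))).trans (hf _)
  obtain ⟨hsol, h0⟩ := finCocycle_spec hν hlam hFL hF0 hF hg x
  refine ⟨fun t => finCocycle ν lam F n (t + (τ - n)) x (shift (-τ) (truncate n f)), ?_, ?_, ?_⟩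
  · have h := hsol.shift (a := τ - n) (by linarith)
    have e : shift (τ - n) (shift (-τ) (truncate n f)) = truncate n (shift (-(n : ℝ)) f) := by
      ext t i
      simp only [shift, truncate, ContinuousMap.comp_apply, ContinuousMap.coe_mk]
      ring_nf
    rwa [e] at h
  · intro t ht
    have h := fin_norm_sq_le hν hlam hF hg hsol (t := t + (τ - n)) (by linarith)
    rw [h0] at h
    exact hT _ (by linarith) _ _ (norm_nonneg _) (hρ x hx) (norm_nonneg _) h
  · rw [dist_comm]
    simpa using hqv

/-- Allows the attracting set to be enlarged by the limit points `U m`, the starting points of the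
trajectories that end at the limit. -/
theorem IsUniformlyAttracting.union {W Y : Type*} [MetricSpace W] {φ : ℝ → W → Y → W} {Y₀ : Set Y}
    {K M : Set W} (hK : IsUniformlyAttracting φ Y₀ K) (hM : IsCompact M) :
    IsUniformlyAttracting φ Y₀ (K ∪ M) := by
  obtain ⟨hne, hc, ha⟩ := hK
  refine ⟨hne.inl, hc.union hM, fun S hS ε hε => ?_⟩
  obtain ⟨T, hT0, hT⟩ := ha S hS ε hε
  exact ⟨T, hT0, fun t ht y hy x hx =>
    (Metric.infDist_le_infDist_of_subset Set.subset_union_left hne).trans_lt (hT t ht y hy x hx)⟩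

/-- Solutions of the lattice system starting from zero have eventually uniformly small tails. -/
theorem exists_tail_zero_le {f : C(ℝ, Ell2)} {K : Set Ell2}
    (hK : IsUniformlyAttracting (latticeCocycle ν lam F) (hull f) K) {η : ℝ} (hη : 0 < η) :
    ∃ m : ℕ, ∃ T ≥ (0 : ℝ), ∀ n : ℕ, ∀ t ≥ T,
      ‖tail m (latticeCocycle ν lam F t 0 (shift (-n) f))‖ ≤ η := by
  obtain ⟨hne, hc, ha⟩ := hK
  obtain ⟨m, hm⟩ := exists_norm_tail_le_of_isCompact hc (half_pos hη)
  obtain ⟨T, hT0, hT⟩ := ha {0} isCompact_singleton (η / 2) (half_pos hη)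
  refine ⟨m, T, hT0, fun n t ht => ?_⟩
  obtain ⟨y, hy, hdy⟩ := (Metric.infDist_lt_iff hne).mp
    (hT t ht _ (shift_mem_hull f (-n)) 0 rfl)
  set w := latticeCocycle ν lam F t 0 (shift (-n) f)
  rw [dist_eq_norm] at hdy
  calc ‖tail m w‖ = ‖tail m (w - y) + tail m y‖ := by rw [← map_add, sub_add_cancel]
    _ ≤ ‖w - y‖ + ‖tail m y‖ := (norm_add_le _ _).trans (by gcongr; exact norm_tail_le _ _)
    _ ≤ η := by linarith [hm y hy]

/-- A subsequence along which the values of the solutions at the times `n - m` converge for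
every `m`, to points which form a relatively compact set. -/
theorem exists_subseq_tendsto {p : (n : ℕ) → ℝ → FinSpace n} {R : ℝ} (hR : 0 ≤ R)
    (hpR : ∀ n, ∀ t ≥ (0 : ℝ), ‖p n t‖ ≤ R)
    (htail : ∀ ε > 0, ∃ k : ℕ, ∃ T : ℝ, ∃ N : ℕ, ∀ n ≥ N, ∀ t ≥ T, ‖tail k (embed n (p n t))‖ ≤ ε) :
    ∃ k : ℕ → ℕ, StrictMono k ∧ ∃ U : ℕ → Ell2, TotallyBounded (Set.range U) ∧
      ∀ m : ℕ, Tendsto (fun j => embed (k j) (p (k j) ((k j : ℝ) - m))) atTop (𝓝 (U m)) := by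
  -- The value `0` for `m > n` replaces negative times, where `p n` is not controlled; it is never
  -- seen in the limit.
  set X : ℕ → ℕ → Ell2 := fun n m => if m ≤ n then embed n (p n ((n : ℝ) - m)) else 0 with hX
  have hXR (n m : ℕ) : ‖X n m‖ ≤ R := by
    simp only [hX]
    split_ifs with h
    · rw [norm_embed]
      exact hpR n _ (sub_nonneg.mpr (by exact_mod_cast h))
    · simpa using hR
  -- The cutoff `k` does not depend on `m`, only the threshold for `n` does; hence the limits `U m`
  -- share the tail bounds.
  have hXt {ε : ℝ} (hε : 0 < ε) : ∃ k : ℕ, ∀ m, ∀ᶠ n in atTop, ‖tail k (X n m)‖ ≤ ε := by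
    obtain ⟨k, T, N, h⟩ := htail ε hε
    refine ⟨k, fun m => ?_⟩
    have hev : ∀ᶠ n : ℕ in atTop, T + m ≤ n := tendsto_natCast_atTop_atTop.eventually_ge_atTop _
    filter_upwards [eventually_ge_atTop N, eventually_ge_atTop m, hev] with n h1 h2 h3
    simp only [hX, if_pos h2]
    exact h n h1 _ (by linarith)
  have hcomp (m : ℕ) : IsCompact (closure (Set.range fun n => X n m)) := by
    refine (TotallyBounded.closure (totallyBounded_of_norm_tail (R := R) ?_ fun ε hε =>
      ?_)).isCompact_of_isClosed isClosed_closure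
    · rintro _ ⟨n, rfl⟩
      exact hXR n m
    · obtain ⟨k, hk⟩ := hXt hε
      obtain ⟨N, hN⟩ := eventually_atTop.mp (hk m)
      have hfin : ((fun n => X n m) '' Set.Iio N).Finite := (Set.finite_Iio N).image _
      obtain ⟨l, hl⟩ := exists_norm_tail_le_of_isCompact hfin.isCompact hε
      refine ⟨max k l, ?_⟩
      rintro _ ⟨n, rfl⟩
      rcases lt_or_ge n N with h | h
      · exact (norm_tail_anti (le_max_right _ _) _).trans (hl _ ⟨n, h, rfl⟩)
      · exact (norm_tail_anti (le_max_left _ _) _).trans (hN n h)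
  -- Sequential compactness of the countable product replaces a diagonal argument.
  obtain ⟨U, -, k, hk, hlim⟩ := (isCompact_univ_pi hcomp).tendsto_subseq (x := X)
    fun n m _ => subset_closure ⟨n, rfl⟩
  rw [tendsto_pi_nhds] at hlim
  refine ⟨k, hk, U, totallyBounded_of_norm_tail (R := R) ?_ fun ε hε => ?_, fun m => ?_⟩
  · rintro _ ⟨m, rfl⟩
    exact le_of_tendsto (hlim m).norm (Eventually.of_forall fun j => hXR _ m)
  · obtain ⟨l, hl⟩ := hXt hε
    refine ⟨l, ?_⟩
    rintro _ ⟨m, rfl⟩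
    exact le_of_tendsto (((tail l).continuous.tendsto _).comp (hlim m)).norm
      (hk.tendsto_atTop.eventually (hl m))
  · refine (hlim m).congr' ?_
    filter_upwards [hk.tendsto_atTop.eventually_ge_atTop m] with j hj
    simp only [hX, Function.comp_apply, if_pos hj]

/-- The limits along a subsequence are related by the lattice cocycle. -/
theorem latticeCocycle_eq_of_tendsto (hν : 0 ≤ ν) (hlam : 0 < lam) (hFL : IsLocLip F)
    (hF0 : F 0 = 0) (hF : ∀ s, F s * s ≤ 0) {f : C(ℝ, Ell2)} {C : ℝ} (hf : ∀ t, ‖f t‖ ≤ C)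
    {p : (n : ℕ) → ℝ → FinSpace n} {R : ℝ}
    (hp : ∀ n, IsFinSolution ν lam F (truncate n (shift (-n) f)) (p n))
    (hpR : ∀ n, ∀ t ≥ (0 : ℝ), ‖p n t‖ ≤ R) {k : ℕ → ℕ} (hk : StrictMono k) {m : ℕ} {x y : Ell2}
    (hx : Tendsto (fun j => embed (k j) (p (k j) ((k j : ℝ) - m))) atTop (𝓝 x))
    (hy : Tendsto (fun j => embed (k j) (p (k j) (k j : ℝ))) atTop (𝓝 y)) :
    latticeCocycle ν lam F m x (shift (-m) f) = y := by
  obtain ⟨hu, hu0⟩ := latticeCocycle_spec hν hlam hFL hF0 hF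
    (norm_le_of_mem_hull hf (shift_mem_hull f (-m))) x
  set u := fun t => latticeCocycle ν lam F t x (shift (-m) f) with hudef
  change u m = y
  have hlim : ∀ ε > 0, ‖y - u m‖ ≤ ε := fun ε hε => by
    obtain ⟨d, hd, N, h⟩ := fin_approximates_lattice hν hlam hFL hu m.cast_nonneg R hε
    refine le_of_tendsto (hy.sub_const (u m)).norm ?_
    have hx' : ∀ᶠ j in atTop, ‖embed (k j) (p (k j) ((k j : ℝ) - m)) - x‖ < d := by
      have := (hx.sub_const x).norm
      rw [sub_self, norm_zero] at this
      exact this.eventually_lt_const hd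
    filter_upwards [hx', hk.tendsto_atTop.eventually_ge_atTop N,
      hk.tendsto_atTop.eventually_ge_atTop m] with j h1 h2 h3
    have h3' : (0 : ℝ) ≤ k j - m := sub_nonneg.mpr (by exact_mod_cast h3)
    -- Restarted at time `k j - m`, the trajectory has the truncation of `f` shifted by `-m` as
    -- forcing, so the lattice solution to compare with is the same for all `j`.
    have hsol := (hp (k j)).shift h3'
    rw [shift_truncate_shift, sub_add_eq_add_sub, add_neg_cancel, zero_sub] at hsol
    have := h (k j) h2 _ hsol (fun t ht => hpR _ _ (add_nonneg ht h3'))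
      (by
        rw [zero_add]
        change ‖_ - latticeCocycle ν lam F 0 x _‖ ≤ d
        rw [hu0]
        exact h1.le)
    rwa [add_sub_cancel] at this
  have h0 : ‖y - u m‖ ≤ 0 := le_of_forall_pos_le_add fun ε hε => by simpa using hlim ε hε
  exact (sub_eq_zero.mp (norm_le_zero_iff.mp h0)).symm

end Main

end LatticeSystem

end

theorem mainTheorem2 (ν lam : ℝ) (hν : 0 ≤ ν) (hlam : 0 < lam)
    (F : ℝ → ℝ)
    (hFlip : ∀ B : Set ℝ, Bornology.IsBounded B → ∃ L : NNReal, LipschitzOnWith L F B)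
    (hF0 : F 0 = 0)
    (hF : ∀ s : ℝ, F s * s ≤ 0)
    (f : C(ℝ, Ell2)) (hf : ∃ C : ℝ, ∀ t : ℝ, ‖f t‖ ≤ C)
    (hI : IsLagrangeStable f ∨
      IsUniformlyCompactlyDissipative (latticeCocycle ν lam F) (hull f))
    (v : (n : ℕ) → FinSpace n)
    (hv : ∀ n : ℕ, 1 ≤ n →
      v n ∈ levinsonCenter (finCocycle ν lam F n) shift (hull (truncate n f)) (truncate n f)) :
    ∃ k : ℕ → ℕ, StrictMono k ∧ (∀ j, 1 ≤ k j) ∧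
      ∃ u ∈ levinsonCenter (latticeCocycle ν lam F) shift (hull f) f,
        Filter.Tendsto (fun j => embed (k j) (v (k j))) Filter.atTop (nhds u) := by
  obtain ⟨C, hf⟩ := hf
  have hC : 0 ≤ C := (norm_nonneg _).trans (hf 0)
  have hFL : IsLocLip F := fun R => by
    obtain ⟨L, hL⟩ := hFlip (Metric.closedBall 0 R) Metric.isBounded_closedBall
    refine ⟨L, L.2, fun s t hs ht => ?_⟩
    simpa [Real.dist_eq] using hL.dist_le_mul s (by simpa using hs) t (by simpa using ht)
  obtain ⟨K, hK⟩ : IsUniformlyCompactlyDissipative (latticeCocycle ν lam F) (hull f) :=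
    hI.elim (isUniformlyCompactlyDissipative_of_isLagrangeStable hν hlam hFL hF0 hF hf) id
  have hR : 0 ≤ C / lam + 1 := by positivity
  have hex (n : ℕ) : ∃ p : ℝ → FinSpace n, IsFinSolution ν lam F (truncate n (shift (-n) f)) p ∧
      (∀ t ≥ (0 : ℝ), ‖p t‖ ≤ C / lam + 1) ∧
      (1 ≤ n → dist (p n) (v n) < 1 / ((n : ℝ) + 1)) := by
    by_cases hn : 1 ≤ n
    · obtain ⟨p, h1, h2, h3⟩ := exists_fin_solution_near hν hlam hFL hF0 hF hf (hv n hn)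
      exact ⟨p, h1, h2, fun _ => h3⟩
    · obtain ⟨h1, h2⟩ := finCocycle_spec hν hlam hFL hF0 hF (norm_truncate_shift_le hf n (-n)) 0
      refine ⟨_, h1, fun t ht => ?_, fun h => absurd h hn⟩
      have h := fin_norm_sq_le hν hlam hF (norm_truncate_shift_le hf n (-n)) h1 ht
      rw [h2, norm_zero] at h
      exact le_radius_of_zero hlam hC h
  choose p hp hpR hpv using hex
  have hg (n : ℕ) (t : ℝ) : ‖shift (-(n : ℝ)) f t‖ ≤ C :=
    norm_le_of_mem_hull hf (shift_mem_hull f _) t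
  have hw (n : ℕ) := latticeCocycle_spec hν hlam hFL hF0 hF (hg n) 0
  have hwR (n : ℕ) (t : ℝ) (ht : t ≥ 0) :
      ‖latticeCocycle ν lam F t 0 (shift (-n) f)‖ ≤ C / lam + 1 := by
    have h := lattice_norm_sq_le hν hlam hFL hF0 hF (hg n) (hw n).1 ht
    rw [(hw n).2, norm_zero] at h
    exact le_radius_of_zero hlam hC h
  obtain ⟨k, hk, U, hU, hlim⟩ := exists_subseq_tendsto hR hpR fun ε hε =>
    exists_fin_tail_le hν hlam hFL hF0 hF hR (fun n => (hw n).1) hp hwR hpR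
      (fun η hη => exists_tail_zero_le hK hη) hε
  have hlim0 : Filter.Tendsto (fun j => embed (k j) (p (k j) (k j : ℝ))) Filter.atTop
      (nhds (U 0)) := by
    simpa using hlim 0
  have hM : IsCompact (closure (Set.range U)) :=
    hU.closure.isCompact_of_isClosed isClosed_closure
  -- Dropping the first term excludes the index `0`, where `v` is unconstrained.
  have hk1 (j : ℕ) : 1 ≤ k (j + 1) := (Nat.le_add_left 1 j).trans (hk.id_le (j + 1))
  refine ⟨fun j => k (j + 1), hk.comp (strictMono_id.add_const 1), hk1, U 0,
    ⟨K ∪ closure (Set.range U), hK.union hM, Set.mem_iInter₂.mpr fun t _ => ?_⟩, ?_⟩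
  -- `U 0` itself lies in the union over `τ ≥ t`: it is the image of `U m` at time `m ≥ t`.
  · obtain ⟨m, hm⟩ := exists_nat_ge t
    refine subset_closure (Set.mem_iUnion₂.mpr ⟨m, hm, U m, Or.inr (subset_closure ⟨m, rfl⟩), ?_⟩)
    exact latticeCocycle_eq_of_tendsto hν hlam hFL hF0 hF hf hp hpR hk (hlim m) hlim0
  · refine tendsto_of_tendsto_of_dist (hlim0.comp (Filter.tendsto_add_atTop_nat 1)) ?_
    refine squeeze_zero (fun _ => dist_nonneg) (fun j => ?_)
      (tendsto_one_div_add_atTop_nhds_zero_nat.comp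
        (hk.tendsto_atTop.comp (Filter.tendsto_add_atTop_nat 1)))
    simp only [Function.comp_apply]
    rw [(isometry_embed _).dist_eq]
    exact (hpv _ (hk1 j)).le
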